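/- Let $n\ge 1$, let $x_1,\dots,x_n\in\mathbb R$ and let $\delta,\mu,\sigma,\tau\in\mathbb R$. For $\lambda=(\lambda_1,\lambda_2,\lambda_3)\in\mathbb R^3$ put $$\Psi_i(\lambda)=\sup_{x\in\mathbb R}\big[\mathbf 1_{\{x\le\tau\}}-\lambda_1(x-x_i)^2-\lambda_2x-\lambda_3x^2\big]\in(-\infty,\infty],$$ $$F(\lambda)=\lambda_1\delta+\lambda_2\mu+\lambda_3(\sigma^2+\mu^2)+\frac1n\sum_{i=1}^n\Psi_i(\lambda).$$ The LZPM dual problem is $\inf\{F(\lambda):\lambda_1\ge0,\ \lambda_2,\lambda_3\in\mathbb R\}$. Substitute $\xi=\lambda_1+\lambda_3$, and for $\xi>0$ let $f(\xi)=\inf\{F(\lambda_1,\lambda_2,\xi-\lambda_1):\lambda_1\ge0,\ \lambda_2\in\mathbb R\}$. 1. Unless $\xi=0$ and $\lambda_2=2\lambda_1x_i$, one has $\Psi_i(\lambda_1,\lambda_2,\xi-\lambda_1)=\widehat\Psi_i(\lambda_1,\lambda_2,\xi)$, where $$\widehat\Psi_i(\lambda_1,\lambda_2,\xi)=-\lambda_1x_i^2+\begin{cases}\infty,&\xi\le0,\\[2pt]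 1+\frac{(2\lambda_1x_i-\lambda_2)^2}{4\xi},&\xi>0,\ \tau\ge\frac{2\lambda_1x_i-\lambda_2}{2\xi},\\[2pt] 1-\xi\tau^2+(2\lambda_1x_i-\lambda_2)\tau,&\xi>0,\ \frac{2\lambda_1x_i-\lambda_2}{2\xi}-\frac1{\sqrt\xi}<\tau<\frac{2\lambda_1x_i-\lambda_2}{2\xi},\\[2pt] \frac{(2\lambda_1x_i-\lambda_2)^2}{4\xi},&\xi>0,\ \tau\le\frac{2\lambda_1x_i-\lambda_2}{2\xi}-\frac1{\sqrt\xi}.\end{cases}$$ In the exceptional case $\xi=0$, $\lambda_2=2\lambda_1x_i$, one has $\Psi_i(\lambda_1,\lambda_2,\xi-\lambda_1)=-\lambda_1x_i^2+1$. 2. Let $\widehat F(\lambda_1,\lambda_2,\xi)=\lambda_1\delta+\lambda_2\mu+(\xi-\lambda_1)(\sigma^2+\mu^2)+\frac1n\sum_{i=1}^n\widehat\Psi_i(\lambda_1,\lambda_2,\xi)$. Then $F(\lambda_1,\lambda_2,\xi-\lambda_1)=\widehat F(\lambda_1,\lambda_2,\xi)$ for $\xi\ne0$. The value of the dual problem equals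 $\inf\{\widehat F(\lambda_1,\lambda_2,\xi):\lambda_1\ge0,\ \lambda_2,\xi\in\mathbb R\}$, and it also equals $\inf_{\xi>0}f(\xi)$; the function $f$ is convex on $(0,\infty)$ (with values in $[-\infty,\infty)$). 3. On a real random access machine (exact real arithmetic $+,-,\times,/,\sqrt{\ }$, rational constants, comparisons of real numbers, and indexed addressing, each operation at unit cost), each of the following can be computed by one program in a number of operations bounded by a polynomial in $n$: (a) from $\delta,\mu,\sigma,\tau,x_1,\dots,x_n$ and $\xi>0$: whether $f(\xi)>-\infty$ and, in that case, the value $f(\xi)$ and a point $(\lambda_1,\lambda_2)$, $\lambda_1\ge0$, at which it is attained; (b) from $\delta,\mu,\sigma,\tau,x_1,\dots,x_n$: whether the dual problem has a finite value and, in that case, this value and an optimal solution $(\lambda_1,\lambda_2,\lambda_3)$. -/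

import Mathlib

/-! ### The dual problem of the distributionally robust lower zeroth partial moment problem -/

/-- Data of the problem: a nonempty sample `x₁, …, xₙ`, the Wasserstein radius `δ`, the prescribed
mean `μ`, the prescribed standard deviation `σ` and the threshold `τ`. -/
structure LZPM where
  n : ℕ
  n_pos : 0 < n
  x : Fin n → ℝ
  δ : ℝ
  μ : ℝ
  σ : ℝ
  τ : ℝ

namespace LZPM

/-- `Ψᵢ(λ) = sup_x [1_{x ≤ τ} - λ₁ (x - xᵢ)² - λ₂ x - λ₃ x²]`, a supremum of real numbers
taken in the extended reals. -/
noncomputable def psi (D : LZPM) (i : Fin D.n) (l₁ l₂ l₃ : ℝ) : EReal :=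
  ⨆ y : ℝ, (((Set.Iic D.τ).indicator (fun _ => (1 : ℝ)) y
    - l₁ * (y - D.x i) ^ 2 - l₂ * y - l₃ * y ^ 2 : ℝ) : EReal)

/-- The dual objective `F(λ) = λ₁ δ + λ₂ μ + λ₃ (σ² + μ²) + (1/n) ∑ᵢ Ψᵢ(λ)`.
Each `Ψᵢ(λ)` is greater than `-∞`, so no sum of the form `∞ - ∞` occurs. -/
noncomputable def dualObj (D : LZPM) (l₁ l₂ l₃ : ℝ) : EReal :=
  ((l₁ * D.δ + l₂ * D.μ + l₃ * (D.σ ^ 2 + D.μ ^ 2) : ℝ) : EReal)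
    + ((1 / (D.n : ℝ) : ℝ) : EReal) * ∑ i, D.psi i l₁ l₂ l₃

/-- The optimal value of the dual problem: the infimum of `F` over `λ₁ ≥ 0` and `λ₂, λ₃ ∈ ℝ`. -/
noncomputable def dualValue (D : LZPM) : EReal :=
  ⨅ (l₁ : ℝ) (_ : 0 ≤ l₁) (l₂ : ℝ) (l₃ : ℝ), D.dualObj l₁ l₂ l₃

/-- `f(ξ)`: the infimum of `F` over `λ₁ ≥ 0` and `λ₂ ∈ ℝ`, where `λ₃ = ξ - λ₁`. -/
noncomputable def innerValue (D : LZPM) (ξ : ℝ) : EReal :=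
  ⨅ (l₁ : ℝ) (_ : 0 ≤ l₁) (l₂ : ℝ), D.dualObj l₁ l₂ (ξ - l₁)

/-- The explicit piecewise expression for `Ψᵢ` in the variables `(λ₁, λ₂, ξ)`. -/
noncomputable def psiExplicit (D : LZPM) (i : Fin D.n) (l₁ l₂ ξ : ℝ) : EReal :=
  ((-(l₁ * D.x i ^ 2) : ℝ) : EReal) +
    if ξ ≤ 0 then ⊤
    else if (2 * l₁ * D.x i - l₂) / (2 * ξ) ≤ D.τ then
      ((1 + (2 * l₁ * D.x i - l₂) ^ 2 / (4 * ξ) : ℝ) : EReal)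
    else if (2 * l₁ * D.x i - l₂) / (2 * ξ) - 1 / √ξ < D.τ then
      ((1 - ξ * D.τ ^ 2 + (2 * l₁ * D.x i - l₂) * D.τ : ℝ) : EReal)
    else (((2 * l₁ * D.x i - l₂) ^ 2 / (4 * ξ) : ℝ) : EReal)

/-- The objective in the variables `(λ₁, λ₂, ξ)`, built from the explicit expressions. -/
noncomputable def explicitObj (D : LZPM) (l₁ l₂ ξ : ℝ) : EReal :=
  ((l₁ * D.δ + l₂ * D.μ + (ξ - l₁) * (D.σ ^ 2 + D.μ ^ 2) : ℝ) : EReal)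
    + ((1 / (D.n : ℝ) : ℝ) : EReal) * ∑ i, D.psiExplicit i l₁ l₂ ξ

end LZPM

/-! ### A real random access machine with unit cost operations

Programs are finite, and they are the same for all input sizes. -/

namespace RealRAM

/-- A configuration: index registers holding natural numbers, and a memory of real numbers. -/
structure State where
  idx : ℕ → ℕ
  mem : ℕ → ℝ

/-- Addresses of memory cells: `at k` is cell number `k`, and `off r k` is the cell whose number
is the content of index register `r` plus `k`. -/
inductive Addr where
  | at (k : ℕ)
  | off (r k : ℕ)

def Addr.eval (s : State) : Addr → ℕ
  | .at k => k
  | .off r k => s.idx r + k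

/-- The content of an addressed cell. -/
def State.get (s : State) (a : Addr) : ℝ := s.mem (a.eval s)

/-- Write a real number into an addressed cell. -/
def State.set (s : State) (a : Addr) (v : ℝ) : State :=
  { s with mem := Function.update s.mem (a.eval s) v }

/-- Write a natural number into an index register. -/
def State.setIdx (s : State) (r v : ℕ) : State :=
  { s with idx := Function.update s.idx r v }

/-- Elementary instructions. Dividing by zero gives `0`, and so does the square root
of a negative number. -/
inductive Instr where
  | skip
  | iconst (r k : ℕ)
  | iadd (r r₁ r₂ : ℕ)
  | isub (r r₁ r₂ : ℕ)
  | const (a : Addr) (q : ℚ)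
  | copy (a a₁ : Addr)
  | add (a a₁ a₂ : Addr)
  | sub (a a₁ a₂ : Addr)
  | mul (a a₁ a₂ : Addr)
  | div (a a₁ a₂ : Addr)
  | sqrt (a a₁ : Addr)

/-- The effect of an elementary instruction. The subtraction of indices is truncated at `0`. -/
noncomputable def Instr.apply (s : State) : Instr → State
  | .skip => s
  | .iconst r k => s.setIdx r k
  | .iadd r r₁ r₂ => s.setIdx r (s.idx r₁ + s.idx r₂)
  | .isub r r₁ r₂ => s.setIdx r (s.idx r₁ - s.idx r₂)
  | .const a q => s.set a (q : ℝ)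
  | .copy a a₁ => s.set a (s.get a₁)
  | .add a a₁ a₂ => s.set a (s.get a₁ + s.get a₂)
  | .sub a a₁ a₂ => s.set a (s.get a₁ - s.get a₂)
  | .mul a a₁ a₂ => s.set a (s.get a₁ * s.get a₂)
  | .div a a₁ a₂ => s.set a (s.get a₁ / s.get a₂)
  | .sqrt a a₁ => s.set a √(s.get a₁)

/-- Tests: strict comparison of two index registers or of two memory cells. -/
inductive Test where
  | idxLt (r₁ r₂ : ℕ)
  | memLt (a₁ a₂ : Addr)

def Test.holds (s : State) : Test → Prop
  | .idxLt r₁ r₂ => s.idx r₁ < s.idx r₂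
  | .memLt a₁ a₂ => s.get a₁ < s.get a₂

inductive Program where
  | instr (c : Instr)
  | seq (P Q : Program)
  | ite (b : Test) (P Q : Program)
  | while (b : Test) (P : Program)

/-- `Exec P s s' t`: started in configuration `s`, the program `P` halts in configuration `s'`
after exactly `t` operations. Every elementary instruction and every test is one operation. -/
inductive Exec : Program → State → State → ℕ → Prop
  | instr (c : Instr) (s : State) : Exec (.instr c) s (c.apply s) 1
  | seq {P Q : Program} {s s' s'' : State} {t t' : ℕ} :
      Exec P s s' t → Exec Q s' s'' t' → Exec (.seq P Q) s s'' (t + t')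
  | ite_true {b : Test} {P Q : Program} {s s' : State} {t : ℕ} :
      b.holds s → Exec P s s' t → Exec (.ite b P Q) s s' (t + 1)
  | ite_false {b : Test} {P Q : Program} {s s' : State} {t : ℕ} :
      ¬ b.holds s → Exec Q s s' t → Exec (.ite b P Q) s s' (t + 1)
  | while_true {b : Test} {P : Program} {s s' s'' : State} {t t' : ℕ} :
      b.holds s → Exec P s s' t → Exec (.while b P) s' s'' t' →
      Exec (.while b P) s s'' (t + t' + 1)
  | while_false {b : Test} {P : Program} {s : State} :
      ¬ b.holds s → Exec (.while b P) s s 1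

/-- The initial configuration: the size is in index register `0`, the input occupies the first
memory cells, everything else is `0`. -/
def start (n : ℕ) (input : List ℝ) : State where
  idx := fun r => if r = 0 then n else 0
  mem := fun k => input.getD k 0

/-- Some program halts on every instance, after a number of operations bounded by a polynomial
in the size of the instance, in a configuration that is a correct answer for the instance. -/
def PolyTime {Inst : Type} (size : Inst → ℕ) (input : Inst → List ℝ)
    (correct : Inst → State → Prop) : Prop :=
  ∃ (P : Program) (p : Polynomial ℕ), ∀ I : Inst, ∃ (s : State) (t : ℕ),
    Exec P (start (size I) (input I)) s t ∧ t ≤ p.eval (size I) ∧ correct I s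

end RealRAM

namespace LZPM

/-- A correct answer for the dual problem: index register `0` tells whether the problem is bounded
below (`1`) or not (`0`); in the bounded case, cell `0` holds the optimal value, and the cells
`1`, `2`, `3` hold an optimal solution `(λ₁, λ₂, λ₃)`. -/
def DualSolved (D : LZPM) (s : RealRAM.State) : Prop :=
  (s.idx 0 = 1 ∧ D.dualValue = ((s.mem 0 : ℝ) : EReal) ∧ 0 ≤ s.mem 1 ∧
    D.dualObj (s.mem 1) (s.mem 2) (s.mem 3) = D.dualValue) ∨
  (s.idx 0 = 0 ∧ D.dualValue = ⊥)

/-- A correct answer for the inner problem, with `ξ` fixed: index register `0` tells whether it is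
bounded below; in the bounded case, cell `0` holds `f(ξ)`, and the cells `1`, `2` hold an optimal
`(λ₁, λ₂)`. -/
def InnerSolved (D : LZPM) (ξ : ℝ) (s : RealRAM.State) : Prop :=
  (s.idx 0 = 1 ∧ D.innerValue ξ = ((s.mem 0 : ℝ) : EReal) ∧ 0 ≤ s.mem 1 ∧
    D.dualObj (s.mem 1) (s.mem 2) (ξ - s.mem 1) = D.innerValue ξ) ∨
  (s.idx 0 = 0 ∧ D.innerValue ξ = ⊥)

end LZPM

/-! ### Real arithmetic in the extended reals -/

/-! Scaling makes all the suprema the same function. Put ξ = r² with r > 0, λ₁ = r p, λ₂ = 2 r w − 2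
r² τ and y = τ + t / r. Then Ψᵢ is a polynomial in (r, p, w) plus φ(p xᵢ − w), where φ(z) = sup_t
[1_{t ≤ 0} + 2 z t − t²] equals 1 + z², 1 or z² for z ≤ 0, 0 < z < 1 or z ≥ 1 (`psi_scaled`). The
objective becomes `obj`: κ r², plus r times a linear form in (p, w), plus the mean of φ(p xᵢ − w).
Points with ξ < 0 have value ∞, finite points with ξ = 0 are limits of points with ξ > 0, and f is
convex as a partial minimum of a jointly convex function.

Boundedness can be read off `obj_eq`: up to a term in [0, 1] and a square that w can make zero,
`obj` is the form σ² r² + slack · r p + var · p². So the dual is bounded exactly when slack ≥ −2 |σ|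
√var, and the inner problem exactly when var > 0 or slack ≥ 0.

For fixed r the objective is convex and piecewise quadratic in (p, w). A minimizer has p = 0, or
lies on a kink line p xᵢ − w = 1, or solves a 2 × 2 linear system attached to an interval of sample
points, or can be moved at no loss to one of the first two kinds (`exists_inner_le`). On a kink line
one variable is left, and the breakpoints and stationary points of the quadratic pieces suffice
(`exists_kink_le`).

For the dual, λ = 0 has value 1, so only points below 1 matter. Along a ray (s r, s p, s w) the
objective has the form α s² + β until some p xᵢ − w reaches 1, so such a point can be moved to a
kink line (`exists_kink_of_obj_lt_one`). There r is eliminated explicitly and `exists_kink_le`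
applies again (`exists_outer_le`).

Either way O(n²) candidates remain, each computable from sums over the sample. The predicate `Comp`
(computable in polynomial time into scratch memory) is closed under arithmetic, branching, sums and
argmin over the sample, which yields the two programs. -/

theorem EReal.coe_sum_real {ι : Type*} (s : Finset ι) (f : ι → ℝ) :
    ((∑ i ∈ s, f i : ℝ) : EReal) = ∑ i ∈ s, (f i : EReal) := by
  classical
  induction s using Finset.induction_on with
  | empty => simp
  | insert a s ha ih => rw [Finset.sum_insert ha, Finset.sum_insert ha, EReal.coe_add, ih]

theorem EReal.sum_ne_bot {ι : Type*} (s : Finset ι) (f : ι → EReal) (h : ∀ i ∈ s, f i ≠ ⊥) :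
    ∑ i ∈ s, f i ≠ ⊥ := by
  classical
  induction s using Finset.induction_on with
  | empty => simp
  | insert a s ha ih =>
    rw [Finset.sum_insert ha, Ne, EReal.add_eq_bot_iff, not_or]
    exact ⟨h a (by simp), ih fun i hi => h i (by simp [hi])⟩

theorem EReal.sum_eq_top {ι : Type*} (s : Finset ι) (f : ι → EReal) (h : ∀ i ∈ s, f i ≠ ⊥)
    {j : ι} (hj : j ∈ s) (hf : f j = ⊤) : ∑ i ∈ s, f i = ⊤ := by
  classical
  rw [← Finset.add_sum_erase s f hj, hf]
  exact EReal.top_add_of_ne_bot (EReal.sum_ne_bot _ _ fun i hi => h i (Finset.mem_of_mem_erase hi))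

/-! ### The function φ and the objective in rescaled variables -/

namespace LZPM

/-- The arithmetic mean of a family indexed by the sample. -/
noncomputable def mean (D : LZPM) (f : Fin D.n → ℝ) : ℝ := 1 / (D.n : ℝ) * ∑ i, f i

/-- The supremum over `t` of `1_{t ≤ 0} + 2 z t - t²`. -/
noncomputable def phi (z : ℝ) : ℝ := if z ≤ 0 then 1 + z ^ 2 else if z < 1 then 1 else z ^ 2

/-- `σ² + (μ - τ)²`. -/
noncomputable def kappa (D : LZPM) : ℝ := D.σ ^ 2 + (D.μ - D.τ) ^ 2

/-- `coefP` and `coefW` are the coefficients of r p and r w in the rescaled objective; they collect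
the linear terms of F and the parts of Ψᵢ other than φ. -/
noncomputable def coefP (D : LZPM) : ℝ :=
  D.δ - (D.σ ^ 2 + D.μ ^ 2) - D.mean (fun i => D.x i ^ 2) + 2 * D.τ * D.mean D.x

noncomputable def coefW (D : LZPM) : ℝ := 2 * (D.μ - D.τ)

/-- The mean of `φ` at the points `p xᵢ - w`. -/
noncomputable def gap (D : LZPM) (p w : ℝ) : ℝ := D.mean fun i => phi (p * D.x i - w)

/-- The dual objective at `λ = (r p, 2 r w - 2 r² τ, r² - r p)`. -/
noncomputable def obj (D : LZPM) (r p w : ℝ) : ℝ :=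
  D.kappa * r ^ 2 + r * (D.coefP * p + D.coefW * w) + D.gap p w

theorem n_pos_real (D : LZPM) : (0 : ℝ) < D.n := by exact_mod_cast D.n_pos

theorem mean_add (D : LZPM) (f g : Fin D.n → ℝ) :
    D.mean (fun i => f i + g i) = D.mean f + D.mean g := by
  simp [mean, Finset.sum_add_distrib, mul_add]

theorem mean_sub (D : LZPM) (f g : Fin D.n → ℝ) :
    D.mean (fun i => f i - g i) = D.mean f - D.mean g := by
  simp [mean, Finset.sum_sub_distrib, mul_sub]

theorem mean_mul (D : LZPM) (c : ℝ) (f : Fin D.n → ℝ) :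
    D.mean (fun i => c * f i) = c * D.mean f := by
  simp only [mean, ← Finset.mul_sum]; ring

theorem mean_const (D : LZPM) (c : ℝ) : D.mean (fun _ => c) = c := by
  have := D.n_pos_real
  simp [mean]; field_simp

theorem mean_le (D : LZPM) {f g : Fin D.n → ℝ} (h : ∀ i, f i ≤ g i) : D.mean f ≤ D.mean g := by
  have := D.n_pos_real
  exact mul_le_mul_of_nonneg_left (Finset.sum_le_sum fun i _ => h i) (by positivity)

theorem mean_congr (D : LZPM) {f g : Fin D.n → ℝ} (h : ∀ i, f i = g i) : D.mean f = D.mean g := by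
  rw [funext h]

theorem one_le_phi (z : ℝ) : 1 ≤ phi z := by
  unfold phi; split_ifs with h1 h2 <;> nlinarith

theorem sq_le_phi (z : ℝ) : z ^ 2 ≤ phi z := by
  unfold phi; split_ifs with h1 h2 <;> nlinarith

theorem phi_le (z : ℝ) : phi z ≤ 1 + z ^ 2 := by
  unfold phi; split_ifs with h1 h2 <;> nlinarith

theorem phi_of_nonpos {z : ℝ} (h : z ≤ 0) : phi z = 1 + z ^ 2 := by simp [phi, h]

theorem phi_of_mem {z : ℝ} (h : 0 ≤ z) (h' : z ≤ 1) : phi z = 1 := by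
  unfold phi; split_ifs with h1 h2
  · have : z = 0 := le_antisymm h1 h
    simp [this]
  · rfl
  · have : z = 1 := by linarith
    simp [this]

theorem phi_of_one_le {z : ℝ} (h : 1 ≤ z) : phi z = z ^ 2 := by
  unfold phi; rw [if_neg (by linarith), if_neg (by linarith)]

/-- Completing the square bounds the expression by z², or by 1 + z² when t ≤ 0. If moreover z ≥ 0,
the term 2 z t is nonpositive and the bound is 1. -/
theorem phi_ge (z t : ℝ) : (Set.Iic (0 : ℝ)).indicator (fun _ => (1 : ℝ)) t + 2 * z * t - t ^ 2 ≤ phi z := by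
  by_cases ht : t ≤ 0
  · rw [Set.indicator_of_mem (by exact ht)]
    rcases le_total z 0 with h | h
    · rw [phi_of_nonpos h]; nlinarith [sq_nonneg (z - t)]
    · nlinarith [one_le_phi z, mul_nonneg h (neg_nonneg.2 ht), sq_nonneg t]
  · rw [Set.indicator_of_notMem (by exact ht)]
    nlinarith [sq_le_phi z, sq_nonneg (z - t)]

theorem exists_phi_eq (z : ℝ) :
    ∃ t, (Set.Iic (0 : ℝ)).indicator (fun _ => (1 : ℝ)) t + 2 * z * t - t ^ 2 = phi z := by
  by_cases h : z ≤ 0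
  · refine ⟨z, ?_⟩
    rw [Set.indicator_of_mem (by exact h), phi_of_nonpos h]; ring
  by_cases h' : z < 1
  · refine ⟨0, ?_⟩
    rw [Set.indicator_of_mem (by simp), phi_of_mem (by linarith) h'.le]; ring
  · refine ⟨z, ?_⟩
    rw [Set.indicator_of_notMem (by simpa using h), phi_of_one_le (by linarith)]; ring

/-! ### The functions `Ψᵢ` -/

/-- The substitution moves the jump to t = 0 and normalizes the quadratic coefficient to 1; the
shift −2 r² τ in λ₂ leaves p xᵢ − w as the only parameter multiplying t. -/
theorem psi_term_eq (D : LZPM) (i : Fin D.n) {r : ℝ} (hr : 0 < r) (p w t : ℝ) :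
    (Set.Iic D.τ).indicator (fun _ => (1 : ℝ)) (D.τ + t / r)
      - r * p * ((D.τ + t / r) - D.x i) ^ 2 - (2 * r * w - 2 * r ^ 2 * D.τ) * (D.τ + t / r)
      - (r ^ 2 - r * p) * (D.τ + t / r) ^ 2 =
    -(r * p * D.x i ^ 2) + (r * D.τ) ^ 2 + 2 * r * D.τ * (p * D.x i - w) +
      ((Set.Iic (0 : ℝ)).indicator (fun _ => (1 : ℝ)) t + 2 * (p * D.x i - w) * t - t ^ 2) := by
  have : (Set.Iic D.τ).indicator (fun _ => (1 : ℝ)) (D.τ + t / r) =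
      (Set.Iic (0 : ℝ)).indicator (fun _ => (1 : ℝ)) t := by
    have h : t / r ≤ 0 ↔ t ≤ 0 := by rw [div_le_iff₀ hr, zero_mul]
    simp only [Set.indicator, Set.mem_Iic, add_le_iff_nonpos_right, h]
  rw [this]; field_simp; ring

theorem psi_scaled (D : LZPM) (i : Fin D.n) {r : ℝ} (hr : 0 < r) (p w : ℝ) :
    D.psi i (r * p) (2 * r * w - 2 * r ^ 2 * D.τ) (r ^ 2 - r * p) =
      ((-(r * p * D.x i ^ 2) + (r * D.τ) ^ 2 + 2 * r * D.τ * (p * D.x i - w)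
        + phi (p * D.x i - w) : ℝ) : EReal) := by
  unfold psi
  apply le_antisymm
  · refine iSup_le fun y => ?_
    have hy : y = D.τ + (r * (y - D.τ)) / r := by field_simp; ring
    rw [hy, D.psi_term_eq i hr p w, EReal.coe_le_coe_iff]
    linarith [phi_ge (p * D.x i - w) (r * (y - D.τ))]
  · obtain ⟨t, ht⟩ := exists_phi_eq (p * D.x i - w)
    refine le_trans (le_of_eq ?_) (le_iSup _ (D.τ + t / r))
    rw [D.psi_term_eq i hr p w, ht]

/-- For fixed r > 0 the rescaling reaches every (λ₁, λ₂), so infima over (λ₁, λ₂) become infima over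
(p, w). -/
theorem eq_scaled (D : LZPM) {r : ℝ} (hr : 0 < r) (l₁ l₂ : ℝ) :
    l₁ = r * (l₁ / r) ∧ l₂ = 2 * r * ((l₂ + 2 * r ^ 2 * D.τ) / (2 * r)) - 2 * r ^ 2 * D.τ := by
  constructor <;> field_simp
  ring

theorem le_psi (D : LZPM) (i : Fin D.n) (l₁ l₂ l₃ y : ℝ) :
    (((Set.Iic D.τ).indicator (fun _ => (1 : ℝ)) y
      - l₁ * (y - D.x i) ^ 2 - l₂ * y - l₃ * y ^ 2 : ℝ) : EReal) ≤ D.psi i l₁ l₂ l₃ :=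
  le_iSup (fun y : ℝ => (((Set.Iic D.τ).indicator (fun _ => (1 : ℝ)) y
      - l₁ * (y - D.x i) ^ 2 - l₂ * y - l₃ * y ^ 2 : ℝ) : EReal)) y

theorem psi_ne_bot (D : LZPM) (i : Fin D.n) (l₁ l₂ l₃ : ℝ) : D.psi i l₁ l₂ l₃ ≠ ⊥ := by
  intro h
  exact EReal.coe_ne_bot _ (le_bot_iff.1 (h ▸ D.le_psi i l₁ l₂ l₃ 0))

theorem psi_eq_top (D : LZPM) (i : Fin D.n) {l₁ l₂ ξ : ℝ} (hξ : ξ ≤ 0)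
    (h : ¬ (ξ = 0 ∧ l₂ = 2 * l₁ * D.x i)) : D.psi i l₁ l₂ (ξ - l₁) = ⊤ := by
  rw [EReal.eq_top_iff_forall_lt]
  intro M
  suffices H : ∃ y : ℝ, M + l₁ * D.x i ^ 2 < (2 * l₁ * D.x i - l₂) * y - ξ * y ^ 2 by
    obtain ⟨y, hy⟩ := H
    refine lt_of_lt_of_le ?_ (le_iSup _ y)
    rw [EReal.coe_lt_coe_iff]
    have : 0 ≤ (Set.Iic D.τ).indicator (fun _ => (1 : ℝ)) y :=
      Set.indicator_nonneg (fun _ _ => zero_le_one) _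
    nlinarith
  set u := 2 * l₁ * D.x i - l₂ with hu
  set K := M + l₁ * D.x i ^ 2
  rcases hξ.lt_or_eq with h0 | h0
  · obtain ⟨s, hs, hsu⟩ : ∃ s : ℝ, s ^ 2 = 1 ∧ 0 ≤ u * s := by
      rcases le_total 0 u with hu | hu
      · exact ⟨1, by norm_num, by linarith⟩
      · exact ⟨-1, by norm_num, by linarith⟩
    have hξ' : 0 < -ξ := by linarith
    -- The sign s makes the linear term nonnegative, and with a = |K| / (−ξ) one has (−ξ)(1 + a)² ≥
    -- −ξ + 2 |K| > K.
    refine ⟨s * (1 + |K| / (-ξ)), ?_⟩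
    have h1 : 0 ≤ |K| / (-ξ) := by positivity
    have h2 : (-ξ) * (|K| / (-ξ)) = |K| := mul_div_cancel₀ _ hξ'.ne'
    have h3 : u * (s * (1 + |K| / (-ξ))) - ξ * (s * (1 + |K| / (-ξ))) ^ 2 =
      u * s * (1 + |K| / (-ξ)) + (-ξ) * (s ^ 2) * (1 + |K| / (-ξ)) ^ 2 := by ring
    rw [h3, hs]
    nlinarith [le_abs_self K, mul_nonneg hsu h1, mul_nonneg hξ'.le (sq_nonneg (|K| / (-ξ)))]
  · have hu0 : u ≠ 0 := fun h' => h ⟨h0, by linarith⟩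
    refine ⟨(K + 1) / u, ?_⟩
    rw [h0, mul_div_cancel₀ _ hu0]; linarith

theorem psi_exceptional (D : LZPM) (i : Fin D.n) (l₁ l₂ ξ : ℝ) (h : ξ = 0 ∧ l₂ = 2 * l₁ * D.x i) :
    D.psi i l₁ l₂ (ξ - l₁) = ((-(l₁ * D.x i ^ 2) + 1 : ℝ) : EReal) := by
  obtain ⟨rfl, rfl⟩ := h
  unfold psi
  apply le_antisymm
  · refine iSup_le fun y => ?_
    rw [EReal.coe_le_coe_iff]
    have : (Set.Iic D.τ).indicator (fun _ => (1 : ℝ)) y ≤ 1 :=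
      Set.indicator_le' (fun _ _ => le_rfl) (fun _ _ => zero_le_one) _
    nlinarith
  · refine le_trans (le_of_eq ?_) (le_iSup _ D.τ)
    rw [EReal.coe_eq_coe_iff, Set.indicator_of_mem (by simp)]
    ring

theorem psi_eq_psiExplicit (D : LZPM) (i : Fin D.n) (l₁ l₂ ξ : ℝ)
    (h : ¬ (ξ = 0 ∧ l₂ = 2 * l₁ * D.x i)) : D.psi i l₁ l₂ (ξ - l₁) = D.psiExplicit i l₁ l₂ ξ := by
  by_cases hξ : ξ ≤ 0
  · rw [D.psi_eq_top i hξ h, psiExplicit, if_pos hξ, EReal.coe_add_top]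
  rw [not_le] at hξ
  obtain ⟨r, hr, rfl⟩ : ∃ r : ℝ, 0 < r ∧ ξ = r ^ 2 := ⟨√ξ, Real.sqrt_pos.2 hξ, (Real.sq_sqrt hξ.le).symm⟩
  obtain ⟨h1, h2⟩ := D.eq_scaled hr l₁ l₂
  set p := l₁ / r
  set w := (l₂ + 2 * r ^ 2 * D.τ) / (2 * r)
  rw [h1, h2, D.psi_scaled i hr p w, psiExplicit, if_neg (not_le.2 hξ), Real.sqrt_sq hr.le]
  have e : (2 * (r * p) * D.x i - (2 * r * w - 2 * r ^ 2 * D.τ)) / (2 * r ^ 2) =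
    D.τ + (p * D.x i - w) / r := by field_simp; ring
  rw [e]
  have e1 : D.τ + (p * D.x i - w) / r ≤ D.τ ↔ p * D.x i - w ≤ 0 := by
    rw [add_le_iff_nonpos_right, div_le_iff₀ hr, zero_mul]
  have e2 : D.τ + (p * D.x i - w) / r - 1 / r < D.τ ↔ p * D.x i - w < 1 := by
    rw [add_sub_assoc, ← sub_div, add_lt_iff_neg_left, div_lt_iff₀ hr, zero_mul, sub_neg]
  simp only [e1, e2]
  unfold phi
  split_ifs <;> rw [← EReal.coe_add, EReal.coe_eq_coe_iff] <;> field_simp <;> ring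

/-! ### The dual objective -/

theorem dualObj_eq_explicitObj (D : LZPM) (l₁ l₂ ξ : ℝ) (h : ξ ≠ 0) :
    D.dualObj l₁ l₂ (ξ - l₁) = D.explicitObj l₁ l₂ ξ := by
  unfold dualObj explicitObj
  simp only [D.psi_eq_psiExplicit _ l₁ l₂ ξ fun h' => h h'.1]

theorem dualObj_of_psi (D : LZPM) (l₁ l₂ l₃ : ℝ) (f : Fin D.n → ℝ)
    (h : ∀ i, D.psi i l₁ l₂ l₃ = (f i : EReal)) :
    D.dualObj l₁ l₂ l₃ =
      ((l₁ * D.δ + l₂ * D.μ + l₃ * (D.σ ^ 2 + D.μ ^ 2) + D.mean f : ℝ) : EReal) := by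
  unfold dualObj mean
  simp only [h]
  rw [← EReal.coe_sum_real, ← EReal.coe_mul, ← EReal.coe_add]

theorem dualObj_scaled (D : LZPM) {r : ℝ} (hr : 0 < r) (p w : ℝ) :
    D.dualObj (r * p) (2 * r * w - 2 * r ^ 2 * D.τ) (r ^ 2 - r * p) = (D.obj r p w : EReal) := by
  rw [D.dualObj_of_psi _ _ _ _ fun i => D.psi_scaled i hr p w, EReal.coe_eq_coe_iff]
  have : D.mean (fun i => -(r * p * D.x i ^ 2) + (r * D.τ) ^ 2 + 2 * r * D.τ * (p * D.x i - w)
        + phi (p * D.x i - w)) = -(r * p) * D.mean (fun i => D.x i ^ 2) + 2 * r * D.τ * p * D.mean D.x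
        + ((r * D.τ) ^ 2 - 2 * r * D.τ * w) + D.gap p w := by
    rw [gap, ← mean_mul, ← mean_mul, ← D.mean_const ((r * D.τ) ^ 2 - 2 * r * D.τ * w), ← mean_add,
      ← mean_add, ← mean_add]
    exact D.mean_congr fun i => by ring
  rw [this]
  unfold obj kappa coefP coefW
  ring

/-- The origin is exceptional for every i. Its value 1 is what the candidates of the dual algorithm
have to beat. -/
theorem dualObj_zero (D : LZPM) : D.dualObj 0 0 0 = 1 := by
  have h : ∀ i, D.psi i 0 0 0 = ((1 : ℝ) : EReal) := fun i => by
    simpa using D.psi_exceptional i 0 0 0 (by simp)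
  rw [D.dualObj_of_psi _ _ _ _ h, mean_const]; norm_num

theorem dualObj_eq_top_of_psi (D : LZPM) {l₁ l₂ l₃ : ℝ} {i : Fin D.n} (h : D.psi i l₁ l₂ l₃ = ⊤) :
    D.dualObj l₁ l₂ l₃ = ⊤ := by
  have := D.n_pos_real
  unfold dualObj
  rw [EReal.sum_eq_top _ _ (fun i _ => D.psi_ne_bot i _ _ _) (Finset.mem_univ i) h,
    EReal.coe_mul_top_of_pos (by positivity), EReal.coe_add_top]

theorem explicitObj_eq_top (D : LZPM) (l₁ l₂ : ℝ) {ξ : ℝ} (h : ξ ≤ 0) :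
    D.explicitObj l₁ l₂ ξ = ⊤ := by
  have := D.n_pos_real
  have hp : ∀ i, D.psiExplicit i l₁ l₂ ξ = ⊤ := fun i => by
    rw [psiExplicit, if_pos h, EReal.coe_add_top]
  unfold explicitObj
  rw [EReal.sum_eq_top _ _ (fun i _ => by simp [hp]) (Finset.mem_univ ⟨0, D.n_pos⟩) (hp _),
    EReal.coe_mul_top_of_pos (by positivity), EReal.coe_add_top]

theorem le_innerValue_iff (D : LZPM) {r : ℝ} (hr : 0 < r) (M : EReal) :
    M ≤ D.innerValue (r ^ 2) ↔ ∀ p w : ℝ, 0 ≤ p → M ≤ D.obj r p w := by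
  unfold innerValue
  simp only [le_iInf_iff]
  constructor
  · intro h p w hp
    rw [← D.dualObj_scaled hr]
    exact h _ (by positivity) _
  · intro h l₁ hl l₂
    obtain ⟨h1, h2⟩ := D.eq_scaled hr l₁ l₂
    rw [h1, h2, D.dualObj_scaled hr]
    exact h _ _ (by positivity)

theorem innerValue_le (D : LZPM) {r p : ℝ} (hr : 0 < r) (hp : 0 ≤ p) (w : ℝ) :
    D.innerValue (r ^ 2) ≤ D.obj r p w := (D.le_innerValue_iff hr _).1 le_rfl p w hp

theorem dualValue_le (D : LZPM) {l₁ : ℝ} (h : 0 ≤ l₁) (l₂ l₃ : ℝ) :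
    D.dualValue ≤ D.dualObj l₁ l₂ l₃ :=
  (iInf₂_le l₁ h).trans ((iInf_le _ l₂).trans (iInf_le _ l₃))

theorem iInf_innerValue_le (D : LZPM) {l₁ ξ : ℝ} (h : 0 ≤ l₁) (hξ : 0 < ξ) (l₂ : ℝ) :
    ⨅ (ξ : ℝ) (_ : 0 < ξ), D.innerValue ξ ≤ D.dualObj l₁ l₂ (ξ - l₁) :=
  (iInf₂_le ξ hξ).trans ((iInf₂_le l₁ h).trans (iInf_le _ l₂))

/-- The points with `ξ = 0` are limits of points with `ξ > 0`, and `F` extends continuously. -/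
theorem iInf_innerValue_le_of_eq_zero (D : LZPM) {l₁ : ℝ} (h : 0 ≤ l₁) (l₂ : ℝ) :
    ⨅ (ξ : ℝ) (_ : 0 < ξ), D.innerValue ξ ≤ D.dualObj l₁ l₂ (0 - l₁) := by
  by_cases hex : ∀ i, l₂ = 2 * l₁ * D.x i
  swap
  · push Not at hex
    obtain ⟨i, hi⟩ := hex
    rw [D.dualObj_eq_top_of_psi (D.psi_eq_top i le_rfl fun h' => hi h'.2)]
    exact le_top
  have h0 := D.dualObj_of_psi l₁ l₂ (0 - l₁) _ fun i => D.psi_exceptional i l₁ l₂ 0 ⟨rfl, hex i⟩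
  rw [h0]
  refine EReal.le_of_forall_lt_iff_le.1 fun z hz => ?_
  rw [EReal.coe_lt_coe_iff] at hz
  set v := l₁ * D.δ + l₂ * D.μ + (0 - l₁) * (D.σ ^ 2 + D.μ ^ 2) +
    D.mean (fun i => -(l₁ * D.x i ^ 2) + 1) with hv
  obtain ⟨r, hr, hrz⟩ : ∃ r : ℝ, 0 < r ∧ v + D.kappa * r ^ 2 ≤ z := by
    have hk : 0 ≤ D.kappa := by unfold kappa; positivity
    refine ⟨√((z - v) / (D.kappa + 1)), Real.sqrt_pos.2 (div_pos (by linarith) (by linarith)), ?_⟩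
    rw [Real.sq_sqrt (div_nonneg (by linarith) (by linarith))]
    have : D.kappa * ((z - v) / (D.kappa + 1)) ≤ z - v := by
      rw [mul_div_assoc', div_le_iff₀ (by linarith)]
      nlinarith
    linarith
  -- This shift of λ₂ keeps every p xᵢ − w equal to 0, so the objective exceeds its value at ξ = 0
  -- by exactly κ r².
  refine (D.iInf_innerValue_le h (pow_pos hr 2) (l₂ - 2 * r ^ 2 * D.τ)).trans ?_
  have e1 : l₁ = r * (l₁ / r) := by field_simp
  have e2 : l₂ = 2 * r * (l₂ / (2 * r)) := by field_simp
  set p := l₁ / r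
  set w := l₂ / (2 * r)
  have hz : ∀ i, p * D.x i - w = 0 := fun i => by
    have : 2 * r * (p * D.x i - w) = 0 := by
      have := hex i
      rw [e1, e2] at this; linarith
    exact (mul_eq_zero.1 this).resolve_left (by positivity)
  rw [e1, e2, D.dualObj_scaled hr, EReal.coe_le_coe_iff]
  refine le_trans (le_of_eq ?_) hrz
  have g1 : D.gap p w = 1 := by
    unfold gap
    rw [← D.mean_const 1]
    exact D.mean_congr fun i => by rw [hz i]; simp [phi]
  have m1 : p * D.mean D.x = w := by
    rw [← mean_mul, ← D.mean_const w]
    exact D.mean_congr fun i => by linarith [hz i]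
  have m2 : D.mean (fun i => -(l₁ * D.x i ^ 2) + 1) = -l₁ * D.mean (fun i => D.x i ^ 2) + 1 := by
    rw [mean_add, mean_const, ← mean_mul]
    congr 1; exact D.mean_congr fun i => by ring
  rw [hv, m2, e1, e2]
  unfold obj
  rw [g1]; unfold coefP coefW kappa
  linear_combination (2 * r * D.τ) * m1

theorem dualValue_eq_iInf_innerValue (D : LZPM) :
    D.dualValue = ⨅ (ξ : ℝ) (_ : 0 < ξ), D.innerValue ξ := by
  apply le_antisymm
  · refine le_iInf₂ fun ξ hξ => le_iInf₂ fun l₁ h => le_iInf fun l₂ => D.dualValue_le h _ _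
  · refine le_iInf₂ fun l₁ h => le_iInf fun l₂ => le_iInf fun l₃ => ?_
    obtain ⟨ξ, rfl⟩ : ∃ ξ, l₃ = ξ - l₁ := ⟨l₃ + l₁, by ring⟩
    rcases lt_trichotomy ξ 0 with hξ | rfl | hξ
    · rw [D.dualObj_eq_top_of_psi (D.psi_eq_top ⟨0, D.n_pos⟩ hξ.le fun h' => hξ.ne h'.1)]
      exact le_top
    · exact D.iInf_innerValue_le_of_eq_zero h l₂
    · exact D.iInf_innerValue_le h hξ l₂

theorem dualValue_eq_iInf_explicitObj (D : LZPM) :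
    D.dualValue = ⨅ (l₁ : ℝ) (_ : 0 ≤ l₁) (l₂ : ℝ) (ξ : ℝ), D.explicitObj l₁ l₂ ξ := by
  apply le_antisymm
  · refine le_iInf₂ fun l₁ h => le_iInf fun l₂ => le_iInf fun ξ => ?_
    by_cases hξ : ξ ≤ 0
    · rw [D.explicitObj_eq_top l₁ l₂ hξ]; exact le_top
    · rw [← D.dualObj_eq_explicitObj l₁ l₂ ξ (by linarith)]
      exact D.dualValue_le h _ _
  · rw [D.dualValue_eq_iInf_innerValue]
    refine le_iInf₂ fun ξ hξ => le_iInf₂ fun l₁ h => le_iInf fun l₂ => ?_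
    rw [D.dualObj_eq_explicitObj l₁ l₂ ξ hξ.ne']
    exact (iInf₂_le l₁ h).trans ((iInf_le _ l₂).trans (iInf_le _ ξ))

theorem le_dualValue_iff (D : LZPM) (M : EReal) :
    M ≤ D.dualValue ↔ ∀ r p w : ℝ, 0 < r → 0 ≤ p → M ≤ D.obj r p w := by
  rw [D.dualValue_eq_iInf_innerValue]
  simp only [le_iInf_iff]
  constructor
  · intro h r p w hr hp
    exact (D.le_innerValue_iff hr M).1 (h _ (pow_pos hr 2)) p w hp
  · intro h ξ hξ
    rw [← Real.sq_sqrt hξ.le, D.le_innerValue_iff (Real.sqrt_pos.2 hξ)]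
    exact fun p w hp => h _ p w (Real.sqrt_pos.2 hξ) hp

/-! ### Convexity in `ξ` -/

/-- Ψᵢ is a supremum of functions that are affine in λ. -/
theorem psi_convex (D : LZPM) (i : Fin D.n) {l₁ l₂ l₃ k₁ k₂ k₃ u v a b : ℝ}
    (hu : D.psi i l₁ l₂ l₃ = (u : EReal)) (hv : D.psi i k₁ k₂ k₃ = (v : EReal))
    (ha : 0 < a) (hb : 0 < b) (hab : a + b = 1) :
    D.psi i (a * l₁ + b * k₁) (a * l₂ + b * k₂) (a * l₃ + b * k₃) ≤ ((a * u + b * v : ℝ) : EReal) := by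
  refine iSup_le fun y => ?_
  have h1 := hu ▸ D.le_psi i l₁ l₂ l₃ y
  have h2 := hv ▸ D.le_psi i k₁ k₂ k₃ y
  simp only [EReal.coe_le_coe_iff] at h1 h2 ⊢
  obtain rfl : b = 1 - a := by linarith
  nlinarith [mul_le_mul_of_nonneg_left h1 ha.le, mul_le_mul_of_nonneg_left h2 hb.le]

theorem psi_real (D : LZPM) (i : Fin D.n) (l₁ l₂ : ℝ) {ξ : ℝ} (hξ : 0 < ξ) :
    ∃ u : ℝ, D.psi i l₁ l₂ (ξ - l₁) = (u : EReal) := by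
  obtain ⟨r, hr, rfl⟩ : ∃ r : ℝ, 0 < r ∧ ξ = r ^ 2 := ⟨√ξ, Real.sqrt_pos.2 hξ, (Real.sq_sqrt hξ.le).symm⟩
  obtain ⟨h1, h2⟩ := D.eq_scaled hr l₁ l₂
  rw [h1, h2]
  exact ⟨_, D.psi_scaled i hr _ _⟩

theorem dualObj_convex (D : LZPM) {ξ η a b : ℝ} (hξ : 0 < ξ) (hη : 0 < η) (ha : 0 < a) (hb : 0 < b)
    (hab : a + b = 1) (l₁ l₂ k₁ k₂ : ℝ) :
    ∃ u v : ℝ, D.dualObj l₁ l₂ (ξ - l₁) = u ∧ D.dualObj k₁ k₂ (η - k₁) = v ∧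
      D.dualObj (a * l₁ + b * k₁) (a * l₂ + b * k₂) ((a * ξ + b * η) - (a * l₁ + b * k₁)) ≤
        ((a * u + b * v : ℝ) : EReal) := by
  choose f hf using fun i => D.psi_real i l₁ l₂ hξ
  choose g hg using fun i => D.psi_real i k₁ k₂ hη
  choose q hq using fun i => D.psi_real i (a * l₁ + b * k₁) (a * l₂ + b * k₂)
    (add_pos (mul_pos ha hξ) (mul_pos hb hη))
  refine ⟨_, _, D.dualObj_of_psi _ _ _ f hf, D.dualObj_of_psi _ _ _ g hg, ?_⟩
  rw [D.dualObj_of_psi _ _ _ q hq, EReal.coe_le_coe_iff]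
  have : D.mean q ≤ a * D.mean f + b * D.mean g := by
    rw [← mean_mul, ← mean_mul, ← mean_add]
    refine D.mean_le fun i => ?_
    have := D.psi_convex i (hf i) (hg i) ha hb hab
    rw [show a * (ξ - l₁) + b * (η - k₁) = a * ξ + b * η - (a * l₁ + b * k₁) by ring, hq i] at this
    exact EReal.coe_le_coe_iff.1 this
  linarith

theorem innerValue_ne_top (D : LZPM) {ξ : ℝ} (hξ : 0 < ξ) : D.innerValue ξ ≠ ⊤ := by
  rw [← Real.sq_sqrt hξ.le]
  exact ne_top_of_le_ne_top (EReal.coe_ne_top _) (D.innerValue_le (Real.sqrt_pos.2 hξ) le_rfl 0)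

theorem exists_of_innerValue_lt (D : LZPM) {ξ : ℝ} {M : EReal} (h : D.innerValue ξ < M) :
    ∃ l₁ l₂ : ℝ, 0 ≤ l₁ ∧ D.dualObj l₁ l₂ (ξ - l₁) < M := by
  simp only [innerValue, iInf_lt_iff] at h
  obtain ⟨l₁, h1, l₂, h2⟩ := h
  exact ⟨l₁, l₂, h1, h2⟩

/-- Partial minimization preserves joint convexity. The infima may be −∞ or not attained, so
near-minimizers are combined; neither summand is ∞, which excludes ∞ − ∞. -/
theorem innerValue_convex (D : LZPM) (ξ η a b : ℝ) (hξ : 0 < ξ) (hη : 0 < η) (ha : 0 < a)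
    (hb : 0 < b) (hab : a + b = 1) :
    D.innerValue (a * ξ + b * η) ≤ (a : EReal) * D.innerValue ξ + (b : EReal) * D.innerValue η := by
  have key : ∀ (c : ℝ) (hc : 0 < c) (ζ : ℝ), 0 < ζ → (c : EReal) * D.innerValue ζ ≠ ⊤ ∧
      ∀ M : EReal, (c : EReal) * D.innerValue ζ < M →
        ∃ l₁ l₂ : ℝ, 0 ≤ l₁ ∧ (c : EReal) * D.dualObj l₁ l₂ (ζ - l₁) ≤ M := by
    intro c hc ζ hζ
    have hz : ∃ M : ℝ, D.innerValue ζ ≤ M := by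
      have := D.innerValue_ne_top hζ
      exact ⟨_, EReal.le_coe_toReal this⟩
    have hc' : (0 : EReal) < c := by exact_mod_cast hc
    constructor
    · obtain ⟨M, hM⟩ := hz
      refine ne_top_of_le_ne_top (EReal.coe_ne_top (c * M)) ?_
      rw [EReal.coe_mul]
      exact mul_le_mul_of_nonneg_left hM hc'.le
    · intro M hM
      obtain ⟨l₁, l₂, h1, h2⟩ := D.exists_of_innerValue_lt (M := M / c) (by
        rw [EReal.lt_div_iff hc' (EReal.coe_ne_top c), mul_comm]; exact hM)
      refine ⟨l₁, l₂, h1, ?_⟩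
      rw [EReal.lt_div_iff hc' (EReal.coe_ne_top c), mul_comm] at h2
      exact h2.le
  obtain ⟨ht1, h1⟩ := key a ha ξ hξ
  obtain ⟨ht2, h2⟩ := key b hb η hη
  refine EReal.le_add_of_forall_gt (Or.inr ht2) (Or.inl ht1) fun M hM N hN => ?_
  obtain ⟨l₁, l₂, hl, hle⟩ := h1 M hM
  obtain ⟨k₁, k₂, hk, hke⟩ := h2 N hN
  obtain ⟨u, v, hu, hv, huv⟩ := D.dualObj_convex hξ hη ha hb hab l₁ l₂ k₁ k₂
  refine ((iInf₂_le (a * l₁ + b * k₁) (by positivity)).trans ((iInf_le _ (a * l₂ + b * k₂)).trans huv)).trans ?_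
  rw [EReal.coe_add, EReal.coe_mul, EReal.coe_mul, ← hu, ← hv]
  exact add_le_add hle hke

end LZPM

/-! ### Total correctness of programs -/

namespace RealRAM

/-- Started in `s`, the program halts after at most `T` operations, in a state satisfying `Q`. -/
def Halts (P : Program) (s : State) (T : ℕ) (Q : State → Prop) : Prop :=
  ∃ s' t, Exec P s s' t ∧ t ≤ T ∧ Q s'

theorem Halts.mono {P : Program} {s : State} {T T' : ℕ} {Q Q' : State → Prop}
    (h : Halts P s T Q) (hT : T ≤ T') (hQ : ∀ s', Q s' → Q' s') : Halts P s T' Q' := by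
  obtain ⟨s', t, he, ht, hq⟩ := h
  exact ⟨s', t, he, ht.trans hT, hQ _ hq⟩

theorem halts_instr {c : Instr} {s : State} {Q : State → Prop} (h : Q (c.apply s)) :
    Halts (.instr c) s 1 Q :=
  ⟨_, _, .instr c s, le_rfl, h⟩

theorem halts_seq {P R : Program} {s : State} {T T' : ℕ} {Q : State → Prop}
    (h : Halts P s T fun s' => Halts R s' T' Q) : Halts (.seq P R) s (T + T') Q := by
  obtain ⟨s', t, he, ht, s'', t', he', ht', hq⟩ := h
  exact ⟨s'', t + t', .seq he he', Nat.add_le_add ht ht', hq⟩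

theorem halts_ite {b : Test} {P R : Program} {s : State} {T : ℕ} {Q : State → Prop}
    (h : b.holds s → Halts P s T Q) (h' : ¬ b.holds s → Halts R s T Q) :
    Halts (.ite b P R) s (T + 1) Q := by
  by_cases hb : b.holds s
  · obtain ⟨s', t, he, ht, hq⟩ := h hb
    exact ⟨s', t + 1, .ite_true hb he, Nat.add_le_add_right ht 1, hq⟩
  · obtain ⟨s', t, he, ht, hq⟩ := h' hb
    exact ⟨s', t + 1, .ite_false hb he, Nat.add_le_add_right ht 1, hq⟩

/-- Induction on the number of remaining rounds: each costs its body and one test, and one last test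
fails. -/
theorem halts_while {b : Test} {B : Program} {n T : ℕ} (Inv : ℕ → State → Prop)
    (hb : ∀ i s, i ≤ n → Inv i s → (b.holds s ↔ i < n))
    (hB : ∀ i s, i < n → Inv i s → Halts B s T (Inv (i + 1))) {s : State} (h0 : Inv 0 s) :
    Halts (.while b B) s (n * (T + 1) + 1) (Inv n) := by
  suffices H : ∀ k i s, i + k = n → Inv i s → Halts (.while b B) s (k * (T + 1) + 1) (Inv n) from
    H n 0 s (by omega) h0
  intro k
  induction k with
  | zero =>
    intro i s hi hs
    have : ¬ b.holds s := by rw [hb i s (by omega) hs]; omega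
    obtain rfl : i = n := by omega
    exact ⟨s, 1, .while_false this, by simp, hs⟩
  | succ k ih =>
    intro i s hi hs
    obtain ⟨s', t, he, ht, hs'⟩ := hB i s (by omega) hs
    obtain ⟨s'', t', he', ht', hq⟩ := ih (i + 1) s' (by omega) hs'
    refine ⟨s'', t + t' + 1, .while_true ((hb i s (by omega) hs).2 (by omega)) he he', ?_, hq⟩
    rw [Nat.succ_mul]; omega

/-- Copy index register `r₁` into the different register `r`. -/
def move (r r₁ : ℕ) : Program := .seq (.instr (.iconst r 0)) (.instr (.iadd r r₁ r))

theorem halts_move {r r₁ : ℕ} (h : r₁ ≠ r) {s : State} {Q : State → Prop}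
    (hQ : Q (s.setIdx r (s.idx r₁))) : Halts (move r r₁) s 2 Q := by
  refine halts_seq (halts_instr (halts_instr ?_))
  simpa [Instr.apply, State.setIdx, Function.update_of_ne h] using hQ

/-- A scratch cell, beyond the input. -/
def tmp (d : ℕ) : Addr := .off 0 (5 + d)

/-- The part of the state that a computation with scratch space from level `d` on preserves. -/
structure Frame (n d : ℕ) (s s' : State) : Prop where
  mem : ∀ k < n + 5 + d, s'.mem k = s.mem k
  idx_even : ∀ v, s'.idx (2 * v) = s.idx (2 * v)
  idx_lt : ∀ r < 2 * d + 3, s'.idx r = s.idx r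

theorem Frame.trans {n d : ℕ} {s s' s'' : State} (h : Frame n d s s') (h' : Frame n d s' s'') :
    Frame n d s s'' :=
  ⟨fun k hk => (h'.mem k hk).trans (h.mem k hk), fun v => (h'.idx_even v).trans (h.idx_even v),
    fun r hr => (h'.idx_lt r hr).trans (h.idx_lt r hr)⟩

theorem Frame.mono {n d d' : ℕ} {s s' : State} (h : Frame n d' s s') (hd : d ≤ d') :
    Frame n d s s' :=
  ⟨fun k hk => h.mem k (by omega), h.idx_even, fun r hr => h.idx_lt r (by omega)⟩

theorem get_tmp {s : State} {n d : ℕ} (h : s.idx 0 = n) : s.get (tmp d) = s.mem (n + 5 + d) := by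
  simp [State.get, tmp, Addr.eval, h, Nat.add_assoc]

theorem set_tmp {s : State} {n d : ℕ} (h : s.idx 0 = n) (v : ℝ) :
    s.set (tmp d) v = ⟨s.idx, Function.update s.mem (n + 5 + d) v⟩ := by
  simp [State.set, tmp, Addr.eval, h, Nat.add_assoc]

theorem frame_set_tmp {s : State} {n d : ℕ} (h : s.idx 0 = n) (v : ℝ) :
    Frame n d s (s.set (tmp d) v) := by
  rw [set_tmp h]
  refine ⟨fun k hk => ?_, fun v => rfl, fun r hr => rfl⟩
  exact Function.update_of_ne (by omega) _ _

end RealRAM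

/-! ### Compiling functions of an instance into programs -/

namespace LZPM

open RealRAM

/-- A problem instance, a value of `ξ`, and the current values of the loop variables. -/
structure Ctx where
  D : LZPM
  ξ : ℝ
  env : ℕ → Fin D.n

/-- Assign a value to a loop variable. -/
def Ctx.bind (c : Ctx) (v : ℕ) (i : Fin c.D.n) : Ctx := ⟨c.D, c.ξ, Function.update c.env v i⟩

/-- The state holds the instance, with the sample stored from cell `base` on, and the
loop variables in the positive even index registers. -/
structure Loads (base : ℕ) (s : State) (c : Ctx) : Prop where
  size : s.idx 0 = c.D.n
  radius : s.mem 0 = c.D.δ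
  expect : s.mem 1 = c.D.μ
  deviation : s.mem 2 = c.D.σ
  threshold : s.mem 3 = c.D.τ
  level : base = 5 → s.mem 4 = c.ξ
  sample : ∀ i, s.mem (base + i.val) = c.D.x i
  loop : ∀ v, s.idx (2 * v + 2) = c.env v

theorem Loads.congr {base d : ℕ} (hb : base ≤ 5) {s s' : State} {c : Ctx} (h : Loads base s c)
    (hs : Frame c.D.n d s s') : Loads base s' c := by
  obtain ⟨h1, h2, h3, h4, h5, h6, h7, h8⟩ := h
  refine ⟨?_, ?_, ?_, ?_, ?_, ?_, ?_, ?_⟩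
  · rw [← h1]; exact hs.idx_even 0
  · rw [hs.mem 0 (by omega), h2]
  · rw [hs.mem 1 (by omega), h3]
  · rw [hs.mem 2 (by omega), h4]
  · rw [hs.mem 3 (by omega), h5]
  · intro h; rw [hs.mem 4 (by omega), h6 h]
  · intro i; rw [hs.mem _ (by omega), h7 i]
  · intro v; rw [← h8 v]; exact hs.idx_even (v + 1)

/-- Some program computes `f` in polynomial time into the scratch cell of level `d`, using scratch
space from level `d` on only. -/
def Comp (base : ℕ) (f : Ctx → ℝ) : Prop :=
  ∀ d : ℕ, ∃ (P : Program) (p : Polynomial ℕ), ∀ (c : Ctx) (s : State), Loads base s c →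
    Halts P s (p.eval c.D.n) fun s' => Frame c.D.n d s s' ∧ s'.mem (c.D.n + 5 + d) = f c

namespace Comp

variable {base : ℕ}

theorem of_instr {f : Ctx → ℝ} (I : Addr → Instr) (v : State → ℝ)
    (hI : ∀ s a, (I a).apply s = s.set a (v s)) (hv : ∀ s c, Loads base s c → v s = f c) :
    Comp base f := by
  refine fun d => ⟨.instr (I (tmp d)), 1, fun c s hs => ?_⟩
  rw [Polynomial.eval_one]
  refine halts_instr ?_
  rw [hI]
  refine ⟨frame_set_tmp hs.size _, ?_⟩
  rw [set_tmp hs.size]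
  simp [hv s c hs]

theorem const (q : ℚ) : Comp base fun _ => (q : ℝ) :=
  of_instr (fun a => .const a q) (fun _ => q) (fun _ _ => rfl) fun _ _ _ => rfl

theorem radius : Comp base fun c => c.D.δ :=
  of_instr (fun a => .copy a (.at 0)) (fun s => s.mem 0) (fun _ _ => rfl) fun _ _ h => h.radius

theorem expect : Comp base fun c => c.D.μ :=
  of_instr (fun a => .copy a (.at 1)) (fun s => s.mem 1) (fun _ _ => rfl) fun _ _ h => h.expect

theorem deviation : Comp base fun c => c.D.σ :=
  of_instr (fun a => .copy a (.at 2)) (fun s => s.mem 2) (fun _ _ => rfl) fun _ _ h => h.deviation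

theorem threshold : Comp base fun c => c.D.τ :=
  of_instr (fun a => .copy a (.at 3)) (fun s => s.mem 3) (fun _ _ => rfl) fun _ _ h => h.threshold

theorem level : Comp 5 fun c => c.ξ :=
  of_instr (fun a => .copy a (.at 4)) (fun s => s.mem 4) (fun _ _ => rfl) fun _ _ h => h.level rfl

theorem sample (v : ℕ) : Comp base fun c => c.D.x (c.env v) :=
  of_instr (fun a => .copy a (.off (2 * v + 2) base)) (fun s => s.mem (s.idx (2 * v + 2) + base))
    (fun _ _ => rfl) fun s c h => by rw [h.loop, Nat.add_comm, h.sample]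

/-! ### Closure under arithmetic and branching -/

variable {f g f' g' : Ctx → ℝ}

theorem binop (hb : base ≤ 5) (I : Addr → Addr → Addr → Instr) (op : ℝ → ℝ → ℝ)
    (hI : ∀ s a a₁ a₂, (I a a₁ a₂).apply s = s.set a (op (s.get a₁) (s.get a₂)))
    (hf : Comp base f) (hg : Comp base g) : Comp base fun c => op (f c) (g c) := by
  intro d
  obtain ⟨P, p, hP⟩ := hf d
  obtain ⟨Q, q, hQ⟩ := hg (d + 1)
  refine ⟨.seq (.seq P Q) (.instr (I (tmp d) (tmp d) (tmp (d + 1)))), p + q + 1, fun c s hs => ?_⟩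
  simp only [Polynomial.eval_add, Polynomial.eval_one]
  refine halts_seq (halts_seq ((hP c s hs).mono le_rfl fun s₁ ⟨h1, h1'⟩ => ?_))
  have hs1 := hs.congr hb h1
  refine (hQ c s₁ hs1).mono le_rfl fun s₂ ⟨h2, h2'⟩ => ?_
  have hs2 := hs1.congr hb h2
  refine halts_instr ?_
  rw [hI]
  refine ⟨(h1.trans (h2.mono (by omega))).trans (frame_set_tmp hs2.size _), ?_⟩
  rw [set_tmp hs2.size, get_tmp hs2.size, get_tmp hs2.size, h2', h2.mem _ (by omega), h1']
  simp

theorem add (hb : base ≤ 5) (hf : Comp base f) (hg : Comp base g) : Comp base fun c => f c + g c :=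
  hf.binop hb .add (· + ·) (fun _ _ _ _ => rfl) hg

theorem sub (hb : base ≤ 5) (hf : Comp base f) (hg : Comp base g) : Comp base fun c => f c - g c :=
  hf.binop hb .sub (· - ·) (fun _ _ _ _ => rfl) hg

theorem mul (hb : base ≤ 5) (hf : Comp base f) (hg : Comp base g) : Comp base fun c => f c * g c :=
  hf.binop hb .mul (· * ·) (fun _ _ _ _ => rfl) hg

theorem div (hb : base ≤ 5) (hf : Comp base f) (hg : Comp base g) : Comp base fun c => f c / g c :=
  hf.binop hb .div (· / ·) (fun _ _ _ _ => rfl) hg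

theorem sqrt (hb : base ≤ 5) (hf : Comp base f) : Comp base fun c => √(f c) :=
  hf.binop hb (fun a a₁ _ => .sqrt a a₁) (fun u _ => √u) (fun _ _ _ _ => rfl) hf

theorem sq (hb : base ≤ 5) (hf : Comp base f) : Comp base fun c => f c ^ 2 := by
  simpa only [pow_two] using hf.mul hb hf

theorem ite_lt (hb : base ≤ 5) (hf : Comp base f) (hg : Comp base g) (hf' : Comp base f')
    (hg' : Comp base g') : Comp base fun c => if f c < g c then f' c else g' c := by
  intro d
  obtain ⟨P, p, hP⟩ := hf d
  obtain ⟨Q, q, hQ⟩ := hg (d + 1)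
  obtain ⟨P', p', hP'⟩ := hf' d
  obtain ⟨Q', q', hQ'⟩ := hg' d
  refine ⟨.seq (.seq P Q) (.ite (.memLt (tmp d) (tmp (d + 1))) P' Q'), p + q + (p' + q' + 1),
    fun c s hs => ?_⟩
  simp only [Polynomial.eval_add, Polynomial.eval_one]
  refine halts_seq (halts_seq ((hP c s hs).mono le_rfl fun s₁ ⟨h1, h1'⟩ => ?_))
  have hs1 := hs.congr hb h1
  refine (hQ c s₁ hs1).mono le_rfl fun s₂ ⟨h2, h2'⟩ => ?_
  have hs2 := hs1.congr hb h2
  have h3 := h1.trans (h2.mono (by omega))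
  have e : (Test.memLt (tmp d) (tmp (d + 1))).holds s₂ ↔ f c < g c := by
    simp only [Test.holds]
    rw [get_tmp hs2.size, get_tmp hs2.size, h2', h2.mem _ (by omega), h1']
  refine halts_ite (fun h => ?_) (fun h => ?_)
  · refine (hP' c s₂ hs2).mono (by omega) fun s₃ ⟨h4, h4'⟩ => ⟨h3.trans h4, ?_⟩
    rw [h4', if_pos (e.1 h)]
  · refine (hQ' c s₂ hs2).mono (by omega) fun s₃ ⟨h4, h4'⟩ => ⟨h3.trans h4, ?_⟩
    rw [h4', if_neg (mt e.2 h)]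

/-- The machine tests only strict inequalities, so the operands and the branches are swapped. -/
theorem ite_le (hb : base ≤ 5) (hf : Comp base f) (hg : Comp base g) (hf' : Comp base f')
    (hg' : Comp base g') : Comp base fun c => if f c ≤ g c then f' c else g' c := by
  have := hg.ite_lt hb hf hg' hf'
  refine Eq.mp (congrArg _ (funext fun c => ?_)) this
  by_cases h : g c < f c
  · rw [if_pos h, if_neg (by linarith)]
  · rw [if_neg h, if_pos (by linarith)]

theorem max (hb : base ≤ 5) (hf : Comp base f) (hg : Comp base g) :
    Comp base fun c => Max.max (f c) (g c) := by
  simpa only [max_def] using hf.ite_le hb hg hg hf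

/-- The state of a loop over variable `v`, run with scratch space from level `d` on, entered
from the state `s₀`. -/
structure LoopState (d v : ℕ) (c : Ctx) (s₀ : State) (i : ℕ) (s : State) : Prop where
  mem : ∀ k < c.D.n + 5 + d, s.mem k = s₀.mem k
  idx_even : ∀ u, u ≠ v + 1 → s.idx (2 * u) = s₀.idx (2 * u)
  idx_lt : ∀ r < 2 * d + 3, r ≠ 2 * v + 2 → s.idx r = s₀.idx r
  counter : s.idx (2 * v + 2) = i
  saved : s.idx (2 * d + 3) = s₀.idx (2 * v + 2)
  one : s.idx (2 * d + 5) = 1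

/-- Register 2 d + 3 saves the old loop variable, which makes nested use possible, and register 2 d
+ 5 holds the increment 1. A body run from level d + 2 on preserves all registers below 2 d + 7,
hence both. -/
def loopStart (d v : ℕ) : Program :=
  .seq (move (2 * d + 3) (2 * v + 2)) (.seq (.instr (.iconst (2 * d + 5) 1)) (.instr (.iconst (2 * v + 2) 0)))

theorem loopState_start (d v : ℕ) (c : Ctx) (s : State) :
    Halts (loopStart d v) s 4 fun s' => LoopState d v c s 0 s' ∧ s'.mem = s.mem := by
  refine halts_seq (halts_move (by omega) (halts_seq (halts_instr (halts_instr ⟨?_, ?_⟩))))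
  · refine ⟨fun _ _ => rfl, fun u hu => ?_, fun r hr hr' => ?_, ?_, ?_, ?_⟩ <;>
      simp only [Instr.apply, State.setIdx] <;> grind
  · rfl

theorem LoopState.loads {d v : ℕ} {c : Ctx} {s₀ s : State} {i : Fin c.D.n} (hb : base ≤ 5)
    (h0 : Loads base s₀ c) (h : LoopState d v c s₀ i s) : Loads base s (c.bind v i) := by
  obtain ⟨h1, h2, h3, h4, h5, h6, h7, h8⟩ := h0
  refine ⟨?_, ?_, ?_, ?_, ?_, ?_, ?_, ?_⟩
  · rw [show (c.bind v i).D = c.D from rfl, ← h1]; exact h.idx_even 0 (by omega)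
  · rw [h.mem 0 (by omega), h2]; rfl
  · rw [h.mem 1 (by omega), h3]; rfl
  · rw [h.mem 2 (by omega), h4]; rfl
  · rw [h.mem 3 (by omega), h5]; rfl
  · intro h'; rw [h.mem 4 (by omega), h6 h']; rfl
  · intro j
    have : j.val < c.D.n := j.2
    rw [h.mem _ (by omega)]; exact h7 j
  · intro u
    by_cases hu : u = v
    · subst hu; rw [h.counter]; simp [Ctx.bind]
    · rw [show 2 * u + 2 = 2 * (u + 1) by ring, h.idx_even (u + 1) (by omega)]
      rw [show 2 * (u + 1) = 2 * u + 2 by ring, h8 u]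
      simp [Ctx.bind, Function.update_of_ne hu]

theorem LoopState.frame {d d' v i : ℕ} {c : Ctx} {s₀ s s' : State} (h : LoopState d v c s₀ i s)
    (hd : d + 2 ≤ d') (hs : Frame c.D.n d' s s') : LoopState d v c s₀ i s' := by
  refine ⟨fun k hk => ?_, fun u hu => ?_, fun r hr hr' => ?_, ?_, ?_, ?_⟩
  · rw [hs.mem k (by omega), h.mem k hk]
  · rw [hs.idx_even, h.idx_even u hu]
  · rw [hs.idx_lt r (by omega), h.idx_lt r hr hr']
  · rw [← h.counter]; exact hs.idx_even (v + 1)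
  · rw [hs.idx_lt _ (by omega), h.saved]
  · rw [hs.idx_lt _ (by omega), h.one]

theorem LoopState.set {d d' v i : ℕ} {c : Ctx} {s₀ s : State} (h : LoopState d v c s₀ i s)
    (hd : d ≤ d') (h0 : s₀.idx 0 = c.D.n) (u : ℝ) : LoopState d v c s₀ i (s.set (tmp d') u) := by
  have hn : s.idx 0 = c.D.n := by rw [← h0]; exact h.idx_even 0 (by omega)
  rw [set_tmp hn]
  refine ⟨fun k hk => ?_, h.idx_even, h.idx_lt, h.counter, h.saved, h.one⟩
  rw [← h.mem k hk]
  exact Function.update_of_ne (by omega) _ _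

theorem LoopState.size {d v i : ℕ} {c : Ctx} {s₀ s : State} (h : LoopState d v c s₀ i s)
    (h0 : s₀.idx 0 = c.D.n) : s.idx 0 = c.D.n := by
  rw [← h0]; exact h.idx_even 0 (by omega)

theorem LoopState.setCounter {d v i j : ℕ} {c : Ctx} {s₀ s : State} (h : LoopState d v c s₀ i s) :
    LoopState d v c s₀ j (s.setIdx (2 * v + 2) j) := by
  obtain ⟨h1, h2, h3, h4, h5, h6⟩ := h
  refine ⟨h1, fun u hu => ?_, fun r hr hr' => ?_, ?_, ?_, ?_⟩ <;>
    simp only [State.setIdx] <;> grind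

theorem LoopState.restore {d v i : ℕ} {c : Ctx} {s₀ s : State} (h : LoopState d v c s₀ i s) :
    Frame c.D.n d s₀ (s.setIdx (2 * v + 2) (s.idx (2 * d + 3))) := by
  obtain ⟨h1, h2, h3, h4, h5, h6⟩ := h
  refine ⟨h1, fun u => ?_, fun r hr => ?_⟩ <;> simp only [State.setIdx] <;> grind

theorem LoopState.test {d v i : ℕ} {c : Ctx} {s₀ s : State} (h : LoopState d v c s₀ i s)
    (h0 : s₀.idx 0 = c.D.n) : (Test.idxLt (2 * v + 2) 0).holds s ↔ i < c.D.n := by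
  simp only [Test.holds]
  rw [h.counter, h.size h0]

theorem LoopState.step {d v i : ℕ} {c : Ctx} {s₀ s : State} (h : LoopState d v c s₀ i s) :
    (Instr.iadd (2 * v + 2) (2 * v + 2) (2 * d + 5)).apply s = s.setIdx (2 * v + 2) (i + 1) := by
  simp only [Instr.apply, h.counter, h.one]

/-- Sums over the sample are computable. -/
theorem sum (hb : base ≤ 5) (v : ℕ) (hf : Comp base f) :
    Comp base fun c => ∑ i, f (c.bind v i) := by
  intro d
  obtain ⟨P, p, hP⟩ := hf (d + 2)
  refine ⟨.seq (loopStart d v) (.seq (.instr (.const (tmp d) 0)) (.seq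
    (.while (.idxLt (2 * v + 2) 0) (.seq P (.seq (.instr (.add (tmp d) (tmp d) (tmp (d + 2))))
      (.instr (.iadd (2 * v + 2) (2 * v + 2) (2 * d + 5))))))
    (move (2 * v + 2) (2 * d + 3)))),
    4 + (1 + (.X * (p + (1 + 1) + 1) + 1 + 2)), fun c s hs => ?_⟩
  simp only [Polynomial.eval_add, Polynomial.eval_one, Polynomial.eval_mul, Polynomial.eval_X,
    Polynomial.eval_ofNat]
  refine halts_seq ((loopState_start d v c s).mono le_rfl fun s₁ ⟨h1, _⟩ => ?_)
  refine halts_seq (halts_instr (halts_seq ?_))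
  -- Extending the summand by zero lets the invariant speak of sums over initial segments of ℕ.
  let F : ℕ → ℝ := fun i => if h : i < c.D.n then f (c.bind v ⟨i, h⟩) else 0
  refine (halts_while (fun i s' => LoopState d v c s i s' ∧
    s'.mem (c.D.n + 5 + d) = ∑ j ∈ Finset.range i, F j) (fun i s' _ h => h.1.test hs.size) ?_ ?_).mono
      le_rfl fun s₂ ⟨h2, h2'⟩ => ?_
  · intro i s' hi ⟨h, h'⟩
    have hl : Loads base s' (c.bind v ⟨i, hi⟩) := LoopState.loads hb hs h
    refine halts_seq ((hP _ s' hl).mono le_rfl fun s₃ ⟨h3, h3'⟩ => ?_)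
    have h4 := h.frame le_rfl h3
    refine halts_seq (halts_instr (halts_instr ?_))
    simp only [Instr.apply.eq_7]
    have h5 := h4.set le_rfl hs.size (s₃.get (tmp d) + s₃.get (tmp (d + 2)))
    rw [h5.step]
    refine ⟨h5.setCounter, ?_⟩
    have e : s₃.mem (c.D.n + 5 + d) = s'.mem (c.D.n + 5 + d) := h3.mem _ (by change _ < c.D.n + 5 + _; omega)
    have e' : s₃.mem (c.D.n + 5 + (d + 2)) = f (c.bind v ⟨i, hi⟩) := h3'
    rw [set_tmp (h4.size hs.size), get_tmp (h4.size hs.size), get_tmp (h4.size hs.size)]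
    simp only [State.setIdx, Function.update_self]
    rw [e, e', h', Finset.sum_range_succ]
    simp [F, hi]
  · refine ⟨h1.set le_rfl hs.size _, ?_⟩
    simp only [Instr.apply]
    rw [set_tmp (h1.size hs.size)]; simp
  · refine halts_move (by omega) ⟨h2.restore, ?_⟩
    simp only [State.setIdx]
    rw [h2', ← Fin.sum_univ_eq_sum_range]
    exact Finset.sum_congr rfl fun i _ => by simp [F]

end Comp

/-- The first minimizer of `key` among the first `k` indices. -/
noncomputable def bestUpTo {n : ℕ} (h0 : 0 < n) (key : Fin n → ℝ) : ℕ → Fin n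
  | 0 => ⟨0, h0⟩
  | k + 1 => if h : k < n then
      if key ⟨k, h⟩ < key (bestUpTo h0 key k) then ⟨k, h⟩ else bestUpTo h0 key k
    else bestUpTo h0 key k

/-- The index minimizing `key`. -/
noncomputable def argmin (D : LZPM) (key : Fin D.n → ℝ) : Fin D.n := bestUpTo D.n_pos key D.n

theorem argmin_le (D : LZPM) (key : Fin D.n → ℝ) (i : Fin D.n) : key (D.argmin key) ≤ key i := by
  suffices H : ∀ k, ∀ i : Fin D.n, i.val < k → key (bestUpTo D.n_pos key k) ≤ key i from H D.n i i.2
  intro k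
  induction k with
  | zero => intro i hi; omega
  | succ k ih =>
    intro i hi
    rw [bestUpTo]
    split_ifs with h h'
    · rcases Nat.lt_succ_iff_lt_or_eq.1 hi with h2 | rfl
      · exact h'.le.trans (ih i h2)
      · exact le_rfl
    · rcases Nat.lt_succ_iff_lt_or_eq.1 hi with h2 | rfl
      · exact ih i h2
      · exact not_lt.1 h'
    · exact ih i (by omega)

/-- Assign to the loop variable `v` the value that minimizes `key`. -/
noncomputable def Ctx.bindMin (c : Ctx) (v : ℕ) (key : Ctx → ℝ) : Ctx :=
  c.bind v (c.D.argmin fun i => key (c.bind v i))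

/-- Scratch cell d keeps the least key so far and register 2 d + 7 its index; running both
subprograms from level d + 3 on protects them. The key is evaluated once at index 0 before the loop,
to initialize the comparison. -/
theorem Comp.bindMin {base : ℕ} {f key : Ctx → ℝ} (hb : base ≤ 5) (v : ℕ) (hkey : Comp base key)
    (hf : Comp base f) : Comp base fun c => f (c.bindMin v key) := by
  intro d
  obtain ⟨P, p, hP⟩ := hkey (d + 3)
  obtain ⟨Q, q, hQ⟩ := hf (d + 3)
  refine ⟨.seq (loopStart d v) (.seq P (.seq (.instr (.copy (tmp d) (tmp (d + 3))))
    (.seq (.instr (.iconst (2 * d + 7) 0)) (.seq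
    (.while (.idxLt (2 * v + 2) 0) (.seq P (.seq
      (.ite (.memLt (tmp (d + 3)) (tmp d))
        (.seq (.instr (.copy (tmp d) (tmp (d + 3)))) (move (2 * d + 7) (2 * v + 2)))
        (.instr .skip))
      (.instr (.iadd (2 * v + 2) (2 * v + 2) (2 * d + 5))))))
    (.seq (move (2 * v + 2) (2 * d + 7)) (.seq Q (.seq (.instr (.copy (tmp d) (tmp (d + 3))))
    (move (2 * v + 2) (2 * d + 3))))))))),
    4 + (p + (1 + (1 + (.X * (p + ((1 + 2 + 1) + 1) + 1) + 1 + (2 + (q + (1 + 2))))))), fun c s hs => ?_⟩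
  simp only [Polynomial.eval_add, Polynomial.eval_one, Polynomial.eval_mul, Polynomial.eval_X,
    Polynomial.eval_ofNat]
  set K : Fin c.D.n → ℝ := fun i => key (c.bind v i) with hK
  refine halts_seq ((loopState_start d v c s).mono le_rfl fun s₁ ⟨h1, _⟩ => ?_)
  have hl : Loads base s₁ (c.bind v ⟨0, c.D.n_pos⟩) := LoopState.loads hb hs h1
  refine halts_seq ((hP _ s₁ hl).mono le_rfl fun s₂ ⟨h2, h2'⟩ => ?_)
  replace h2 := h1.frame (by omega) h2
  refine halts_seq (halts_instr (halts_seq (halts_instr (halts_seq ?_))))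
  have idx7 : ∀ {i : ℕ} {s' : State} (j : ℕ), LoopState d v c s i s' →
      LoopState d v c s i (s'.setIdx (2 * d + 7) j) := by
    rintro i s' j ⟨h1, h2, h3, h4, h5, h6⟩
    refine ⟨h1, fun u hu => ?_, fun r hr hr' => ?_, ?_, ?_, ?_⟩ <;>
      simp only [State.setIdx] <;> grind
  refine (halts_while (fun i s' => LoopState d v c s i s' ∧
    s'.mem (c.D.n + 5 + d) = K (bestUpTo c.D.n_pos K i) ∧
    s'.idx (2 * d + 7) = bestUpTo c.D.n_pos K i)
      (fun i s' _ h => h.1.test hs.size) ?_ ?_).mono le_rfl fun s₃ ⟨h3, h3', h3''⟩ => ?_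
  · intro i s' hi ⟨h, h', h''⟩
    have hl : Loads base s' (c.bind v ⟨i, hi⟩) := LoopState.loads hb hs h
    refine halts_seq ((hP _ s' hl).mono le_rfl fun s₃ ⟨h3, h3'⟩ => ?_)
    have h4 := h.frame (by omega) h3
    have hn := h4.size hs.size
    have e : s₃.mem (c.D.n + 5 + d) = K (bestUpTo c.D.n_pos K i) :=
      (h3.mem _ (by change _ < c.D.n + 5 + _; omega)).trans h'
    have e' : s₃.mem (c.D.n + 5 + (d + 3)) = K ⟨i, hi⟩ := h3'
    have e'' : s₃.idx (2 * d + 7) = bestUpTo c.D.n_pos K i := (h3.idx_lt _ (by omega)).trans h''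
    have et : (Test.memLt (tmp (d + 3)) (tmp d)).holds s₃ ↔
        K ⟨i, hi⟩ < K (bestUpTo c.D.n_pos K i) := by
      simp only [Test.holds]
      rw [get_tmp hn, get_tmp hn, e, e']
    refine halts_seq (halts_ite (fun hlt => ?_) (fun hlt => ?_))
    · refine halts_seq (halts_instr (halts_move (by omega) (halts_instr ?_)))
      simp only [Instr.apply.eq_6]
      have h5 := h4.set le_rfl hs.size (s₃.get (tmp (d + 3)))
      rw [(idx7 _ h5).step]
      refine ⟨(idx7 _ h5).setCounter, ?_, ?_⟩
      · rw [set_tmp hn, get_tmp hn, e']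
        simp [State.setIdx, bestUpTo, hi, et.1 hlt]
      · rw [h5.counter]
        simp only [State.setIdx, bestUpTo, hi, et.1 hlt, if_true, dif_pos]
        rw [Function.update_of_ne (by omega), Function.update_self]
    · refine (halts_instr (halts_instr ?_)).mono (by omega) fun _ h => h
      simp only [Instr.apply.eq_1]
      rw [h4.step]
      refine ⟨h4.setCounter, ?_, ?_⟩
      · simp only [State.setIdx, bestUpTo, hi, mt et.2 hlt, if_false, dif_pos]
        exact e
      · simp only [State.setIdx, bestUpTo, hi, mt et.2 hlt, if_false, dif_pos]
        rw [Function.update_of_ne (by omega), e'']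
  · have hn := h2.size hs.size
    simp only [Instr.apply]
    refine ⟨idx7 _ (h2.set le_rfl hs.size _), ?_, ?_⟩
    · rw [set_tmp hn, get_tmp hn]
      simp only [State.setIdx, Function.update_self, bestUpTo]
      exact h2'
    · simp [State.setIdx, bestUpTo]
  · refine halts_seq (halts_move (by omega) (halts_seq ?_))
    rw [h3'']
    have h4 : LoopState d v c s (c.D.argmin K) (s₃.setIdx (2 * v + 2) (bestUpTo c.D.n_pos K c.D.n)) :=
      h3.setCounter
    have hl : Loads base _ (c.bind v (c.D.argmin K)) := LoopState.loads hb hs h4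
    refine (hQ _ _ hl).mono le_rfl fun s₄ ⟨h5, h5'⟩ => ?_
    replace h5 := h4.frame (by omega) h5
    refine halts_seq (halts_instr (halts_move (by omega) ?_))
    have hn := h5.size hs.size
    simp only [Instr.apply]
    refine ⟨(h5.set le_rfl hs.size _).restore, ?_⟩
    rw [set_tmp hn, get_tmp hn]
    simp only [State.setIdx, Function.update_self]
    exact h5'

/-- A program that evaluates four functions and a flag. -/
theorem Comp.output {base : ℕ} (hb : base ≤ 5) {f₀ f₁ f₂ f₃ g : Ctx → ℝ} (h0 : Comp base f₀)
    (h1 : Comp base f₁) (h2 : Comp base f₂) (h3 : Comp base f₃) (hg : Comp base g) :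
    ∃ (P : Program) (p : Polynomial ℕ), ∀ (c : Ctx) (s : State), Loads base s c →
      Halts P s (p.eval c.D.n) fun s' => s'.mem 0 = f₀ c ∧ s'.mem 1 = f₁ c ∧ s'.mem 2 = f₂ c ∧
        s'.mem 3 = f₃ c ∧ s'.idx 0 = if g c < 0 then 0 else 1 := by
  obtain ⟨P0, p0, hP0⟩ := h0 0
  obtain ⟨P1, p1, hP1⟩ := h1 1
  obtain ⟨P2, p2, hP2⟩ := h2 2
  obtain ⟨P3, p3, hP3⟩ := h3 3
  obtain ⟨P4, p4, hP4⟩ := hg 4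
  -- Cells 0 to 3 hold inputs and register 0 anchors the scratch addresses. Hence results are copied
  -- down only after all evaluations, and register 0 is overwritten last.
  refine ⟨.seq P0 (.seq P1 (.seq P2 (.seq P3 (.seq P4 (.seq (.instr (.const (tmp 5) 0)) (.seq
    (.instr (.copy (.at 0) (tmp 0))) (.seq (.instr (.copy (.at 1) (tmp 1))) (.seq
    (.instr (.copy (.at 2) (tmp 2))) (.seq (.instr (.copy (.at 3) (tmp 3)))
    (.ite (.memLt (tmp 4) (tmp 5)) (.instr (.iconst 0 0)) (.instr (.iconst 0 1)))))))))))),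
    p0 + (p1 + (p2 + (p3 + (p4 + (1 + (1 + (1 + (1 + (1 + (1 + 1)))))))))), fun c s hs => ?_⟩
  simp only [Polynomial.eval_add, Polynomial.eval_one]
  refine halts_seq ((hP0 c s hs).mono le_rfl fun s₀ ⟨a0, b0⟩ => ?_)
  have hs := hs.congr hb a0
  refine halts_seq ((hP1 c _ hs).mono le_rfl fun s₁ ⟨a1, b1⟩ => ?_)
  have hs := hs.congr hb a1
  refine halts_seq ((hP2 c _ hs).mono le_rfl fun s₂ ⟨a2, b2⟩ => ?_)
  have hs := hs.congr hb a2
  refine halts_seq ((hP3 c _ hs).mono le_rfl fun s₃ ⟨a3, b3⟩ => ?_)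
  have hs := hs.congr hb a3
  refine halts_seq ((hP4 c _ hs).mono le_rfl fun s₄ ⟨a4, b4⟩ => ?_)
  have hs := hs.congr hb a4
  have e0 : s₄.mem (c.D.n + 5) = f₀ c := by
    rw [a4.mem _ (by omega), a3.mem _ (by omega), a2.mem _ (by omega), a1.mem _ (by omega)]; exact b0
  have e1 : s₄.mem (c.D.n + 5 + 1) = f₁ c := by
    rw [a4.mem _ (by omega), a3.mem _ (by omega), a2.mem _ (by omega)]; exact b1
  have e2 : s₄.mem (c.D.n + 5 + 2) = f₂ c := by
    rw [a4.mem _ (by omega), a3.mem _ (by omega)]; exact b2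
  have e3 : s₄.mem (c.D.n + 5 + 3) = f₃ c := by
    rw [a4.mem _ (by omega)]; exact b3
  have e : ∀ d, tmp d = .off 0 (5 + d) := fun _ => rfl
  refine halts_seq (halts_instr (halts_seq (halts_instr (halts_seq (halts_instr (halts_seq
    (halts_instr (halts_seq (halts_instr (halts_ite (fun h => halts_instr ?_) (fun h => halts_instr ?_)))))))))))
  all_goals
    have hn := hs.size
    simp [Instr.apply, Test.holds, State.set, State.get, e, Addr.eval, State.setIdx, hn, e0, e1, e2, e3, b4] at h ⊢
    simp [h]

end LZPM

/-! ### Minimization of a quadratic polynomial on an interval -/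

/-- For α > 0 clip the vertex to the interval. For α ≤ 0 the graph lies below its tangent at t₀, so
walking downhill along the tangent reaches an endpoint at no loss. -/
theorem exists_quadratic_le_of_mem_Icc (α β γ : ℝ) {lo hi t₀ : ℝ} (h1 : lo ≤ t₀) (h2 : t₀ ≤ hi) :
    ∃ t, lo ≤ t ∧ t ≤ hi ∧ α * t ^ 2 + β * t + γ ≤ α * t₀ ^ 2 + β * t₀ + γ ∧
      (t = lo ∨ t = hi ∨ t = -β / (2 * α)) := by
  rcases lt_or_ge 0 α with hα | hα
  · obtain ⟨m, hm⟩ : ∃ m, m = -β / (2 * α) := ⟨_, rfl⟩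
    obtain rfl : β = -2 * α * m := by rw [hm]; field_simp
    rcases lt_or_ge m lo with h | h
    · exact ⟨lo, le_rfl, h1.trans h2, by
        nlinarith [mul_nonneg hα.le (mul_nonneg (sub_nonneg.2 h1) (by linarith : 0 ≤ t₀ + lo - 2 * m))],
        .inl rfl⟩
    rcases lt_or_ge hi m with h' | h'
    · exact ⟨hi, h1.trans h2, le_rfl, by
        nlinarith [mul_nonneg hα.le (mul_nonneg (sub_nonneg.2 h2) (by linarith : 0 ≤ 2 * m - t₀ - hi))],
        .inr (.inl rfl)⟩
    · exact ⟨m, h, h', by nlinarith [mul_nonneg hα.le (sq_nonneg (t₀ - m))], .inr (.inr hm)⟩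
  · rcases le_total 0 (2 * α * t₀ + β) with h | h
    · exact ⟨lo, le_rfl, h1.trans h2, by
        nlinarith [mul_nonneg (sub_nonneg.2 h1) h, mul_nonneg (neg_nonneg.2 hα) (sq_nonneg (t₀ - lo))],
        .inl rfl⟩
    · exact ⟨hi, h1.trans h2, le_rfl, by
        nlinarith [mul_nonneg (sub_nonneg.2 h2) (neg_nonneg.2 h),
          mul_nonneg (neg_nonneg.2 hα) (sq_nonneg (t₀ - hi))], .inr (.inl rfl)⟩

/-- The lower bound M replaces the right endpoint: α ≤ 0 with a strictly negative slope at t₀ would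
make the quadratic unbounded below. -/
theorem exists_quadratic_le_of_mem_Ici (α β γ : ℝ) {lo t₀ M : ℝ} (h1 : lo ≤ t₀)
    (hM : ∀ t, lo ≤ t → M ≤ α * t ^ 2 + β * t + γ) :
    ∃ t, lo ≤ t ∧ α * t ^ 2 + β * t + γ ≤ α * t₀ ^ 2 + β * t₀ + γ ∧
      (t = lo ∨ t = -β / (2 * α)) := by
  rcases lt_or_ge 0 α with hα | hα
  · obtain ⟨m, hm⟩ : ∃ m, m = -β / (2 * α) := ⟨_, rfl⟩
    obtain rfl : β = -2 * α * m := by rw [hm]; field_simp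
    rcases lt_or_ge m lo with h | h
    · exact ⟨lo, le_rfl, by
        nlinarith [mul_nonneg hα.le (mul_nonneg (sub_nonneg.2 h1) (by linarith : 0 ≤ t₀ + lo - 2 * m))],
        .inl rfl⟩
    · exact ⟨m, h, by nlinarith [mul_nonneg hα.le (sq_nonneg (t₀ - m))], .inr hm⟩
  · rcases le_or_gt 0 (2 * α * t₀ + β) with h | h
    · exact ⟨lo, le_rfl, by
        nlinarith [mul_nonneg (sub_nonneg.2 h1) h, mul_nonneg (neg_nonneg.2 hα) (sq_nonneg (t₀ - lo))],
        .inl rfl⟩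
    · exfalso
      have h0 := hM t₀ h1
      set q₀ := α * t₀ ^ 2 + β * t₀ + γ with hq
      set s := (q₀ - M + 1) / -(2 * α * t₀ + β) with hs
      have hs0 : 0 ≤ s := div_nonneg (by linarith) (by linarith)
      have hs1 : s * (2 * α * t₀ + β) = -(q₀ - M + 1) := by
        rw [hs, div_mul_eq_mul_div, div_eq_iff (by linarith)]; ring
      have := hM (t₀ + s) (by linarith)
      nlinarith [mul_nonneg (neg_nonneg.2 hα) (sq_nonneg s)]

namespace LZPM

/-! ### Boundedness -/

noncomputable def var (D : LZPM) : ℝ := D.mean fun i => (D.x i - D.mean D.x) ^ 2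

/-- The excess of the radius over a part of the squared Gelbrich distance. -/
noncomputable def slack (D : LZPM) : ℝ := D.δ - D.σ ^ 2 - D.var - (D.μ - D.mean D.x) ^ 2

theorem mean_nonneg (D : LZPM) {f : Fin D.n → ℝ} (h : ∀ i, 0 ≤ f i) : 0 ≤ D.mean f := by
  have := D.mean_le h
  rwa [mean_const] at this

theorem var_nonneg (D : LZPM) : 0 ≤ D.var := D.mean_nonneg fun _ => sq_nonneg _

theorem mean_sq_affine (D : LZPM) (p w : ℝ) :
    D.mean (fun i => (p * D.x i - w) ^ 2) =
      p ^ 2 * D.mean (fun i => D.x i ^ 2) - 2 * p * w * D.mean D.x + w ^ 2 := by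
  rw [← D.mean_const (w ^ 2), ← mean_mul, ← mean_mul, ← mean_sub, ← mean_add]
  exact D.mean_congr fun i => by ring

theorem var_eq (D : LZPM) : D.var = D.mean (fun i => D.x i ^ 2) - D.mean D.x ^ 2 := by
  have := D.mean_sq_affine 1 (D.mean D.x)
  simp only [one_mul] at this
  rw [var, this]; ring

/-- Completes the square in w. Since z² ≤ φ(z) ≤ 1 + z², the last mean lies in [0, 1], so
boundedness depends only on the quadratic form in r and p. -/
theorem obj_eq (D : LZPM) (r p w : ℝ) :
    D.obj r p w = D.σ ^ 2 * r ^ 2 + D.slack * (r * p) + D.var * p ^ 2 +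
      (w - D.mean D.x * p + r * (D.μ - D.τ)) ^ 2 +
      D.mean (fun i => phi (p * D.x i - w) - (p * D.x i - w) ^ 2) := by
  rw [mean_sub, mean_sq_affine, slack, var_eq, obj, kappa, coefP, coefW, gap]
  ring

theorem obj_ge (D : LZPM) (r p w : ℝ) :
    D.σ ^ 2 * r ^ 2 + D.slack * (r * p) + D.var * p ^ 2 +
      (w - D.mean D.x * p + r * (D.μ - D.τ)) ^ 2 ≤ D.obj r p w := by
  rw [obj_eq]
  have := D.mean_nonneg (f := fun i => phi (p * D.x i - w) - (p * D.x i - w) ^ 2)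
    fun i => sub_nonneg.2 (sq_le_phi _)
  linarith

theorem obj_le (D : LZPM) (r p : ℝ) :
    D.obj r p (D.mean D.x * p - r * (D.μ - D.τ)) ≤
      D.σ ^ 2 * r ^ 2 + D.slack * (r * p) + D.var * p ^ 2 + 1 := by
  rw [obj_eq]
  have := D.mean_le (f := fun i => phi (p * D.x i - (D.mean D.x * p - r * (D.μ - D.τ))) -
    (p * D.x i - (D.mean D.x * p - r * (D.μ - D.τ))) ^ 2) (g := fun _ => 1)
    fun i => by linarith [phi_le (p * D.x i - (D.mean D.x * p - r * (D.μ - D.τ)))]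
  rw [mean_const] at this
  nlinarith

theorem obj_nonneg (D : LZPM) (h : -(2 * |D.σ| * √D.var) ≤ D.slack) {r p : ℝ} (hr : 0 ≤ r)
    (hp : 0 ≤ p) (w : ℝ) : 0 ≤ D.obj r p w := by
  refine le_trans ?_ (D.obj_ge r p w)
  have h1 := mul_le_mul_of_nonneg_right h (mul_nonneg hr hp)
  nlinarith [Real.sq_sqrt D.var_nonneg, sq_abs D.σ, sq_nonneg (|D.σ| * r - √D.var * p),
    sq_nonneg (w - D.mean D.x * p + r * (D.μ - D.τ))]

theorem dualValue_eq_bot (D : LZPM) (h : D.slack < -(2 * |D.σ| * √D.var)) : D.dualValue = ⊥ := by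
  obtain ⟨r, p, hr, hp, hf⟩ : ∃ r p : ℝ, 0 < r ∧ 0 < p ∧
      D.σ ^ 2 * r ^ 2 + D.slack * (r * p) + D.var * p ^ 2 < 0 := by
    have hv := D.var_nonneg
    have h0 : D.slack < 0 := h.trans_le (by simp only [neg_nonpos]; positivity)
    rcases hv.eq_or_lt with hv | hv
    · refine ⟨1, (D.σ ^ 2 + 1) / -D.slack, one_pos, div_pos (by positivity) (by linarith), ?_⟩
      have : D.slack * ((D.σ ^ 2 + 1) / -D.slack) = -(D.σ ^ 2 + 1) := by
        rw [mul_div_assoc', div_eq_iff (by linarith)]; ring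
      rw [← hv]; linarith
    rcases eq_or_ne D.σ 0 with hs | hs
    · refine ⟨(D.var + 1) / -D.slack, 1, div_pos (by positivity) (by linarith), one_pos, ?_⟩
      have : D.slack * ((D.var + 1) / -D.slack) = -(D.var + 1) := by
        rw [mul_div_assoc', div_eq_iff (by linarith)]; ring
      rw [hs]; linarith
    · have h1 := Real.sqrt_pos.2 hv
      have h2 := abs_pos.2 hs
      -- On this direction |σ| r = √var · p, the equality case of σ² r² + var · p² ≥ 2 |σ| √var · r
      -- p.
      refine ⟨√D.var, |D.σ|, h1, h2, ?_⟩
      have h3 := mul_lt_mul_of_pos_right h (mul_pos h1 h2)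
      nlinarith [Real.sq_sqrt hv.le, sq_abs D.σ]
  rw [EReal.eq_bot_iff_forall_lt]
  intro M
  set c := -(D.σ ^ 2 * r ^ 2 + D.slack * (r * p) + D.var * p ^ 2)
  have hc : 0 < c := by simp only [c]; linarith
  set s := 1 + (|M| + 1) / c with hs
  have hs1 : 1 ≤ s := by
    have : 0 ≤ (|M| + 1) / c := by positivity
    linarith
  have hs0 : 0 < s := by linarith
  have hsc : |M| + 1 + c = s * c := by rw [hs]; field_simp; ring
  have key := D.obj_le (s * r) (s * p)
  refine lt_of_le_of_lt ((D.le_dualValue_iff _).1 le_rfl _ _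
    (D.mean D.x * (s * p) - (s * r) * (D.μ - D.τ)) (mul_pos hs0 hr) (mul_pos hs0 hp).le) ?_
  rw [EReal.coe_lt_coe_iff]
  have e : D.σ ^ 2 * (s * r) ^ 2 + D.slack * (s * r * (s * p)) + D.var * (s * p) ^ 2 = -(s * (s * c)) := by
    simp only [c]; ring
  rw [e] at key
  nlinarith [neg_abs_le M, abs_nonneg M, mul_pos hs0 hc]

/-- With var = 0 the quadratic form is affine in p, with slope slack · r < 0. -/
theorem innerValue_eq_bot (D : LZPM) (hv : D.var = 0) (h : D.slack < 0) {r : ℝ} (hr : 0 < r) :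
    D.innerValue (r ^ 2) = ⊥ := by
  rw [EReal.eq_bot_iff_forall_lt]
  intro M
  have hc : 0 < -(D.slack * r) := by nlinarith
  set p := (D.σ ^ 2 * r ^ 2 + |M| + 2) / -(D.slack * r) with hp
  have hp0 : 0 ≤ p := by positivity
  have e : D.slack * (r * p) = -(D.σ ^ 2 * r ^ 2 + |M| + 2) := by
    rw [← mul_assoc, hp, mul_div_assoc', div_eq_iff hc.ne']; ring
  refine lt_of_le_of_lt (D.innerValue_le hr hp0 (D.mean D.x * p - r * (D.μ - D.τ))) ?_
  rw [EReal.coe_lt_coe_iff]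
  have key := D.obj_le r p
  rw [e, hv] at key
  linarith [neg_abs_le M]

/-! ### Minimization on the lines where some `p xᵢ - w` equals `1` -/

/-- Mean over the sample points outside of `[x k, x i)`. -/
noncomputable def meanOffIco (D : LZPM) (k i : Fin D.n) (f : Fin D.n → ℝ) : ℝ :=
  D.mean fun l => if D.x l < D.x k then f l else if D.x l < D.x i then 0 else f l

/-- The stationary point of a quadratic piece of `c₂ p² + c₁ p + gap p (p xᵢ - 1)`. -/
noncomputable def kinkStat (D : LZPM) (c₂ c₁ : ℝ) (i k : Fin D.n) : ℝ :=
  -(c₁ + 2 * D.meanOffIco k i fun l => D.x l - D.x i) /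
    (2 * (c₂ + D.meanOffIco k i fun l => (D.x l - D.x i) ^ 2))

/-- For p ≥ 0 the sign condition is monotone in the sample value, so its solutions fill a segment [x
k, x i). Thus an index k names the quadratic piece; k = i encodes the empty segment. -/
theorem exists_threshold (D : LZPM) (i : Fin D.n) {p : ℝ} (hp : 0 ≤ p) :
    ∃ k, ∀ l, (D.x l < D.x i ∧ 0 < 1 + p * (D.x l - D.x i)) ↔ (¬ D.x l < D.x k ∧ D.x l < D.x i) := by
  classical
  by_cases hB : ∃ l, D.x l < D.x i ∧ 0 < 1 + p * (D.x l - D.x i)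
  · obtain ⟨k, hk, hmin⟩ := Finset.exists_min_image
      (Finset.univ.filter fun l => D.x l < D.x i ∧ 0 < 1 + p * (D.x l - D.x i)) D.x
      (by obtain ⟨l, hl⟩ := hB; exact ⟨l, by simpa using hl⟩)
    simp only [Finset.mem_filter, Finset.mem_univ, true_and] at hk hmin
    refine ⟨k, fun l => ⟨fun h => ⟨not_lt.2 (hmin l h), h.1⟩, fun h => ⟨h.2, ?_⟩⟩⟩
    have := mul_le_mul_of_nonneg_left (not_lt.1 h.1) hp
    nlinarith [hk.2]
  · push Not at hB
    exact ⟨i, fun l => ⟨fun h => absurd h.2 (not_lt.2 (hB l h.1)), fun h => absurd h.2 h.1⟩⟩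

/-- On a `p`-interval where no `1 + p (x l - x i)` changes sign, the function is quadratic. -/
theorem gap_kink_eq (D : LZPM) (i : Fin D.n) {p : ℝ} (hp : 0 ≤ p) :
    ∃ k, ∃ γ : ℝ, ∀ t : ℝ, 0 ≤ t →
      (∀ l, D.x l < D.x i → (0 < 1 + p * (D.x l - D.x i) → 0 ≤ 1 + t * (D.x l - D.x i)) ∧
        (1 + p * (D.x l - D.x i) ≤ 0 → 1 + t * (D.x l - D.x i) ≤ 0)) →
      D.gap t (t * D.x i - 1) = (D.meanOffIco k i fun l => (D.x l - D.x i) ^ 2) * t ^ 2 +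
        (2 * D.meanOffIco k i fun l => D.x l - D.x i) * t + γ := by
  obtain ⟨k, hk⟩ := D.exists_threshold i hp
  -- With z = 1 + t (x l − x i), φ is z², 1 or 1 + z² on the three groups of points, with constant
  -- terms 1, 1 and 2.
  refine ⟨k, D.mean fun l => if D.x l < D.x i ∧ 1 + p * (D.x l - D.x i) ≤ 0 then 2 else 1,
    fun t ht h => ?_⟩
  have e : ∀ a b c : ℝ, a * t ^ 2 + 2 * b * t + c = t ^ 2 * a + 2 * t * b + c := fun a b c => by ring
  rw [e, meanOffIco, meanOffIco, ← mean_mul, ← mean_mul, ← mean_add, ← mean_add]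
  refine D.mean_congr fun l => ?_
  rw [show t * D.x l - (t * D.x i - 1) = 1 + t * (D.x l - D.x i) by ring]
  by_cases h1 : D.x l < D.x i
  · by_cases h2 : 0 < 1 + p * (D.x l - D.x i)
    · have h3 := ((hk l).1 ⟨h1, h2⟩).1
      rw [phi_of_mem ((h l h1).1 h2) (by nlinarith), if_neg h3, if_pos h1, if_neg h3, if_pos h1,
        if_neg (fun h => absurd h2 (not_lt.2 h.2))]
      ring
    · have h3 : D.x l < D.x k := by
        by_contra h'
        exact h2 ((hk l).2 ⟨h', h1⟩).2
      rw [phi_of_nonpos ((h l h1).2 (not_lt.1 h2)), if_pos h3, if_pos h3, if_pos ⟨h1, not_lt.1 h2⟩]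
      ring
  · rw [phi_of_one_le (by nlinarith)]
    simp only [h1, false_and, if_false, ite_self]
    ring

/-- The half-line t ≥ 0 is cut at the end b / e of the constraint and at the zeros of 1 + t (x k − x
i). On the piece around p the function is a quadratic, whose minimum is at an end or at the
stationary point; the bound M is needed when the piece is unbounded. -/
theorem exists_kink_le (D : LZPM) (i : Fin D.n) {c₂ c₁ c₀ e b M : ℝ}
    (hM : ∀ t, 0 ≤ t → e * t ≤ b → M ≤ c₂ * t ^ 2 + c₁ * t + c₀ + D.gap t (t * D.x i - 1))
    {p : ℝ} (hp : 0 ≤ p) (he : e * p ≤ b) :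
    ∃ t, 0 ≤ t ∧ e * t ≤ b ∧ c₂ * t ^ 2 + c₁ * t + c₀ + D.gap t (t * D.x i - 1) ≤
      c₂ * p ^ 2 + c₁ * p + c₀ + D.gap p (p * D.x i - 1) ∧
      (t = 0 ∨ (∃ k, t = -1 / (D.x k - D.x i)) ∨ (∃ k, t = D.kinkStat c₂ c₁ i k) ∨
        (e ≠ 0 ∧ e * t = b)) := by
  classical
  -- If e = 0 or x k = x i, division by zero contributes the point 0, which is present anyway.
  set S : Finset ℝ := {0, b / e} ∪ Finset.univ.image fun k => -1 / (D.x k - D.x i) with hS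
  have hmem : ∀ s ∈ S, s = 0 ∨ (∃ k, s = -1 / (D.x k - D.x i)) ∨ (∃ k, s = D.kinkStat c₂ c₁ i k) ∨
        (e ≠ 0 ∧ e * s = b) := by
    intro s hs
    simp only [hS, Finset.mem_union, Finset.mem_insert, Finset.mem_singleton, Finset.mem_image,
      Finset.mem_univ, true_and] at hs
    rcases hs with (rfl | rfl) | ⟨k, rfl⟩
    · exact .inl rfl
    · by_cases h : e = 0
      · left; simp [h]
      · exact .inr (.inr (.inr ⟨h, mul_div_cancel₀ _ h⟩))
    · exact .inr (.inl ⟨k, rfl⟩)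
  have h0S : (0 : ℝ) ∈ S := by simp [hS]
  have hbS : b / e ∈ S := by simp [hS]
  have hkS : ∀ k, -1 / (D.x k - D.x i) ∈ S := fun k => by simp [hS]
  by_cases hpS : p ∈ S
  · exact ⟨p, hp, he, le_rfl, hmem p hpS⟩
  have hp0 : 0 < p := lt_of_le_of_ne hp fun h => hpS (h ▸ h0S)
  obtain ⟨lo, hlo, hmax⟩ := Finset.exists_max_image (S.filter (· < p)) id ⟨0, by simp [h0S, hp0]⟩
  simp only [Finset.mem_filter, id] at hlo hmax
  have hlo0 : 0 ≤ lo := hmax 0 ⟨h0S, hp0⟩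
  obtain ⟨k, γ, hk⟩ := D.gap_kink_eq i hp
  have sep : ∀ t, lo ≤ t → (∀ s ∈ S, p < s → t ≤ s) → ∀ s ∈ S, (s ≤ t ∧ s < p) ∨ (t ≤ s ∧ p < s) := by
    intro t h1 h2 s hs
    rcases lt_trichotomy s p with h | rfl | h
    · exact .inl ⟨(hmax s ⟨hs, h⟩).trans h1, h⟩
    · exact absurd hs hpS
    · exact .inr ⟨h2 s hs h, h⟩
  have quad : ∀ t, lo ≤ t → (∀ s ∈ S, p < s → t ≤ s) → 0 ≤ t ∧ e * t ≤ b ∧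
      c₂ * t ^ 2 + c₁ * t + c₀ + D.gap t (t * D.x i - 1) =
      (c₂ + D.meanOffIco k i fun l => (D.x l - D.x i) ^ 2) * t ^ 2 +
        (c₁ + 2 * D.meanOffIco k i fun l => D.x l - D.x i) * t + (c₀ + γ) := by
    intro t h1 h2
    have ht := hlo0.trans h1
    have hsep := sep t h1 h2
    refine ⟨ht, ?_, ?_⟩
    · rcases lt_trichotomy e 0 with h | h | h
      · have h3 : b / e * e = b := div_mul_cancel₀ _ h.ne
        rcases hsep _ hbS with h4 | h4 <;> nlinarith
      · subst h; linarith
      · have h3 : b / e * e = b := div_mul_cancel₀ _ h.ne'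
        rcases hsep _ hbS with h4 | h4 <;> nlinarith
    · rw [hk t ht]
      · ring
      · intro l hl
        have hd : D.x l - D.x i < 0 := by linarith
        have h3 : -1 / (D.x l - D.x i) * (D.x l - D.x i) = -1 := div_mul_cancel₀ _ hd.ne
        rcases hsep _ (hkS l) with h4 | h4
        · constructor <;> intro h5 <;> nlinarith
        · constructor <;> intro h5 <;> nlinarith
  have hp1 := quad p hlo.2.le fun s _ h => h.le
  by_cases hne : (S.filter (p < ·)).Nonempty
  · obtain ⟨hi, hhi, hmin⟩ := Finset.exists_min_image _ id hne
    simp only [Finset.mem_filter, id] at hhi hmin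
    obtain ⟨t, h1, h2, h3, h4⟩ := exists_quadratic_le_of_mem_Icc
      (c₂ + D.meanOffIco k i fun l => (D.x l - D.x i) ^ 2)
      (c₁ + 2 * D.meanOffIco k i fun l => D.x l - D.x i) (c₀ + γ) hlo.2.le hhi.2.le
    obtain ⟨q1, q2, q3⟩ := quad t h1 fun s hs h => h2.trans (hmin s ⟨hs, h⟩)
    refine ⟨t, q1, q2, by rw [q3, hp1.2.2]; exact h3, ?_⟩
    rcases h4 with rfl | rfl | h4
    · exact hmem _ hlo.1
    · exact hmem _ hhi.1
    · exact .inr (.inr (.inl ⟨k, h4⟩))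
  · have hall : ∀ t : ℝ, ∀ s ∈ S, p < s → t ≤ s := fun t s hs h =>
      absurd ⟨s, Finset.mem_filter.2 ⟨hs, h⟩⟩ hne
    obtain ⟨t, h1, h3, h4⟩ := exists_quadratic_le_of_mem_Ici
      (c₂ + D.meanOffIco k i fun l => (D.x l - D.x i) ^ 2)
      (c₁ + 2 * D.meanOffIco k i fun l => D.x l - D.x i) (c₀ + γ) (M := M) hlo.2.le (fun t ht => by
        obtain ⟨q1, q2, q3⟩ := quad t ht (hall t)
        rw [← q3]; exact hM t q1 q2)
    obtain ⟨q1, q2, q3⟩ := quad t h1 (hall t)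
    refine ⟨t, q1, q2, by rw [q3, hp1.2.2]; exact h3, ?_⟩
    rcases h4 with rfl | h4
    · exact hmem _ hlo.1
    · exact .inr (.inr (.inl ⟨k, h4⟩))

/-! ### The dual problem: reduction to finitely many points -/

theorem one_le_gap (D : LZPM) (p w : ℝ) : 1 ≤ D.gap p w := by
  have := D.mean_le (f := fun _ => 1) (g := fun i => phi (p * D.x i - w)) fun i => one_le_phi _
  rwa [mean_const] at this

/-- The optimal `r ≥ 0` on the line `w = p xᵢ - 1`. -/
noncomputable def outerR (D : LZPM) (i : Fin D.n) (p : ℝ) : ℝ :=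
  max 0 ((D.coefW - (D.coefP + D.coefW * D.x i) * p) / (2 * D.kappa))

noncomputable def outerBreak (D : LZPM) (i k : Fin D.n) : ℝ := max 0 (-1 / (D.x k - D.x i))

noncomputable def outerStat (D : LZPM) (i k : Fin D.n) : ℝ :=
  max 0 (D.kinkStat (-((D.coefP + D.coefW * D.x i) ^ 2 / (4 * D.kappa)))
    (2 * D.coefW * (D.coefP + D.coefW * D.x i) / (4 * D.kappa)) i k)

/-- Moving along a ray, one reaches a point with some `p xᵢ - w = 1` at no loss. -/
theorem exists_kink_of_obj_lt_one (D : LZPM) (h : -(2 * |D.σ| * √D.var) ≤ D.slack) {r p : ℝ}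
    (hr : 0 < r) (hp : 0 ≤ p) (w : ℝ) (h1 : D.obj r p w < 1) :
    ∃ (i : Fin D.n) (r' p' : ℝ), 0 < r' ∧ 0 ≤ p' ∧ D.obj r' p' (p' * D.x i - 1) ≤ D.obj r p w := by
  classical
  set z : Fin D.n → ℝ := fun i => p * D.x i - w with hz
  set α := D.kappa * r ^ 2 + r * (D.coefP * p + D.coefW * w) +
    D.mean (fun i => if 0 < z i ∧ z i < 1 then 0 else z i ^ 2) with hα
  set β := D.mean (fun i => if z i < 1 then 1 else 0) with hβ
  -- The part outside `gap` is homogeneous of degree two, and while no z crosses 1 each φ(s z) is s²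
  -- z², 1 or 1 + s² z² without changing case.
  have ray : ∀ s : ℝ, 0 < s → (∀ i, z i < 1 → s * z i ≤ 1) → (∀ i, 1 ≤ z i → 1 ≤ s * z i) →
      D.obj (s * r) (s * p) (s * w) = α * s ^ 2 + β := by
    intro s hs h2 h3
    have : D.gap (s * p) (s * w) = s ^ 2 * D.mean (fun i => if 0 < z i ∧ z i < 1 then 0 else z i ^ 2) + β := by
      rw [hβ, ← mean_mul, ← mean_add]
      refine D.mean_congr fun i => ?_
      rw [show s * p * D.x i - s * w = s * z i by simp only [hz]; ring]
      by_cases h4 : z i < 1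
      · by_cases h5 : 0 < z i
        · rw [phi_of_mem (mul_pos hs h5).le (h2 i h4), if_pos ⟨h5, h4⟩, if_pos h4]; ring
        · rw [phi_of_nonpos (by nlinarith), if_neg (fun h => h5 h.1), if_pos h4]; ring
      · rw [phi_of_one_le (h3 i (not_lt.1 h4)), if_neg (fun h => h4 h.2), if_neg h4]; ring
    rw [obj, this, hα]; ring
  have hkink : ∀ i, 0 < z i → (1 / z i) * w = (1 / z i * p) * D.x i - 1 := fun i hi => by
    have : z i = p * D.x i - w := rfl
    field_simp; linarith
  have hone := ray 1 one_pos (fun i h => by linarith) (fun i h => by linarith)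
  simp only [one_mul, one_pow, mul_one] at hone
  -- If α ≥ 0, shrink until the least z ≥ 1 equals 1; without such a z, β = 1 and the value would be
  -- at least 1. If α < 0, expand until the greatest z in (0, 1) equals 1; without such a z, the ray
  -- would lead to negative values.
  rcases le_or_gt 0 α with h0 | h0
  · by_cases hne : ∃ i, 1 ≤ z i
    · obtain ⟨i, hi, hmin⟩ := Finset.exists_min_image (Finset.univ.filter fun i => 1 ≤ z i) z
        (by obtain ⟨i, hi⟩ := hne; exact ⟨i, by simpa using hi⟩)
      simp only [Finset.mem_filter, Finset.mem_univ, true_and] at hi hmin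
      have hzi : 0 < z i := by linarith
      have hs : 0 < 1 / z i := by positivity
      have hs1 : 1 / z i ≤ 1 := by rw [div_le_one hzi]; exact hi
      have hs2 : 1 / z i * z i = 1 := by field_simp
      refine ⟨i, 1 / z i * r, 1 / z i * p, by positivity, by positivity, ?_⟩
      rw [← hkink i hzi, ray _ hs, hone]
      · nlinarith [mul_nonneg h0 (mul_nonneg (sub_nonneg.2 hs1) (by linarith : 0 ≤ 1 + 1 / z i))]
      · intro j hj
        rcases le_or_gt (z j) 0 with h' | h' <;> nlinarith
      · intro j hj
        nlinarith [hmin j hj]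
    · exfalso
      push Not at hne
      have : β = 1 := (D.mean_congr fun i => if_pos (hne i)).trans (D.mean_const 1)
      linarith
  · by_cases hne : ∃ i, 0 < z i ∧ z i < 1
    · obtain ⟨i, hi, hmax⟩ := Finset.exists_max_image (Finset.univ.filter fun i => 0 < z i ∧ z i < 1) z
        (by obtain ⟨i, hi⟩ := hne; exact ⟨i, by simpa using hi⟩)
      simp only [Finset.mem_filter, Finset.mem_univ, true_and] at hi hmax
      have hzi : 0 < z i := hi.1
      have hs : 0 < 1 / z i := by positivity
      have hs1 : 1 ≤ 1 / z i := by rw [le_div_iff₀ hzi]; linarith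
      have hs2 : 1 / z i * z i = 1 := by field_simp
      refine ⟨i, 1 / z i * r, 1 / z i * p, by positivity, by positivity, ?_⟩
      rw [← hkink i hzi, ray _ hs, hone]
      · nlinarith [mul_nonneg (neg_nonneg.2 h0.le)
          (mul_nonneg (sub_nonneg.2 hs1) (by linarith : 0 ≤ 1 + 1 / z i))]
      · intro j hj
        rcases le_or_gt (z j) 0 with h' | h'
        · nlinarith
        · nlinarith [hmax j ⟨h', hj⟩]
      · intro j hj
        nlinarith
    · exfalso
      push Not at hne
      have hβ0 : 0 ≤ β := D.mean_nonneg fun i => by split_ifs <;> norm_num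
      set s := 1 + β / -α with hs
      have hs0 : 0 ≤ β / -α := div_nonneg hβ0 (by linarith)
      have hs1 : s * α = α - β := by
        rw [hs, add_mul, one_mul, div_mul_eq_mul_div, mul_div_assoc, div_neg, div_self h0.ne]; ring
      have := ray s (by linarith) (fun j hj => by
        have : z j ≤ 0 := by
          by_contra h'
          exact absurd hj (not_lt.2 (hne j (not_le.1 h')))
        nlinarith) (fun j hj => by nlinarith)
      have h3 := D.obj_nonneg h (mul_pos (by linarith : 0 < s) hr).le
        (mul_nonneg (by linarith : 0 ≤ s) hp) (s * w)
      rw [this] at h3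
      nlinarith

/-- If κ = 0 then also `coefW` vanishes and the objective is affine in r, starting from `gap` ≥ 1. A
value below 1 forces a negative slope, and large r contradicts nonnegativity. -/
theorem kappa_pos_of_obj_lt_one (D : LZPM) (h : -(2 * |D.σ| * √D.var) ≤ D.slack) {r p : ℝ}
    (hr : 0 < r) (hp : 0 ≤ p) (w : ℝ) (h1 : D.obj r p w < 1) : 0 < D.kappa := by
  have hk : 0 ≤ D.kappa := by unfold kappa; positivity
  refine lt_of_le_of_ne hk fun h0 => ?_
  have hb : D.coefW = 0 := by
    have : D.μ - D.τ = 0 := by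
      unfold kappa at h0
      nlinarith [sq_nonneg D.σ, sq_nonneg (D.μ - D.τ)]
    rw [coefW, this, mul_zero]
  have hg := D.one_le_gap p w
  unfold obj at h1
  rw [← h0, hb] at h1
  set a := -(r * (D.coefP * p)) with ha
  have ha0 : 0 < a := by linarith
  set s := D.gap p w / a + 1 with hs
  have hs0 : 0 < s := by
    have : 0 ≤ D.gap p w / a := div_nonneg (by linarith) ha0.le
    linarith
  have h2 := D.obj_nonneg h (mul_pos hs0 hr).le hp w
  have hsa : s * a = D.gap p w + a := by rw [hs]; field_simp
  unfold obj at h2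
  rw [← h0, hb] at h2
  have : s * r * (D.coefP * p + 0 * w) = -(s * a) := by rw [ha]; ring
  linarith

theorem obj_outerR_le (D : LZPM) (hk : 0 < D.kappa) (i : Fin D.n) {r : ℝ} (hr : 0 ≤ r) (p : ℝ) :
    D.obj (D.outerR i p) p (p * D.x i - 1) ≤ D.obj r p (p * D.x i - 1) := by
  set u := (D.coefW - (D.coefP + D.coefW * D.x i) * p) / (2 * D.kappa) with hu
  have h1 : D.coefP * p + D.coefW * (p * D.x i - 1) = -(2 * D.kappa * u) := by
    rw [hu, mul_div_cancel₀ _ (by positivity)]; ring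
  unfold obj outerR
  rw [h1, ← hu]
  rcases le_total 0 u with h | h
  · rw [max_eq_right h]; nlinarith [mul_nonneg hk.le (sq_nonneg (r - u))]
  · rw [max_eq_left h]
    nlinarith [mul_nonneg hk.le (sq_nonneg r), mul_nonneg hk.le (mul_nonneg hr (neg_nonneg.2 h))]

theorem obj_outerR_eq (D : LZPM) (hk : 0 < D.kappa) (i : Fin D.n) {p : ℝ}
    (h : (D.coefP + D.coefW * D.x i) * p ≤ D.coefW) :
    D.obj (D.outerR i p) p (p * D.x i - 1) =
      -((D.coefP + D.coefW * D.x i) ^ 2 / (4 * D.kappa)) * p ^ 2 +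
        2 * D.coefW * (D.coefP + D.coefW * D.x i) / (4 * D.kappa) * p +
        -(D.coefW ^ 2 / (4 * D.kappa)) + D.gap p (p * D.x i - 1) := by
  unfold obj outerR
  rw [max_eq_right (div_nonneg (by linarith) (by positivity))]
  field_simp; ring

/-- The constraint passed to `exists_kink_le` says that the vertex in r is nonnegative. On its
boundary and beyond it the best r is 0, where the objective is `gap` ≥ 1, so a value below 1 rules
these points out. -/
theorem exists_outer_le (D : LZPM) (h : -(2 * |D.σ| * √D.var) ≤ D.slack) {r p : ℝ}
    (hr : 0 < r) (hp : 0 ≤ p) (w : ℝ) (h1 : D.obj r p w < 1) :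
    ∃ i k, D.obj (D.outerR i (D.outerBreak i k)) (D.outerBreak i k) (D.outerBreak i k * D.x i - 1) ≤
        D.obj r p w ∨
      D.obj (D.outerR i (D.outerStat i k)) (D.outerStat i k) (D.outerStat i k * D.x i - 1) ≤
        D.obj r p w := by
  have hk := D.kappa_pos_of_obj_lt_one h hr hp w h1
  obtain ⟨i, r', p', hr', hp', hle⟩ := D.exists_kink_of_obj_lt_one h hr hp w h1
  have hle2 := (D.obj_outerR_le hk i hr'.le p').trans hle
  have hdom : (D.coefP + D.coefW * D.x i) * p' ≤ D.coefW := by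
    by_contra hlt
    have : D.outerR i p' = 0 := max_eq_left (div_nonpos_of_nonpos_of_nonneg (by linarith) (by linarith))
    rw [this, obj] at hle2
    linarith [D.one_le_gap p' (p' * D.x i - 1)]
  obtain ⟨t, ht, htd, hq, hc⟩ := D.exists_kink_le i (M := 0)
    (c₂ := -((D.coefP + D.coefW * D.x i) ^ 2 / (4 * D.kappa)))
    (c₁ := 2 * D.coefW * (D.coefP + D.coefW * D.x i) / (4 * D.kappa))
    (c₀ := -(D.coefW ^ 2 / (4 * D.kappa))) (fun t ht htd => by
      rw [← D.obj_outerR_eq hk i htd]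
      exact D.obj_nonneg h (le_max_left _ _) ht _) hp' hdom
  rw [← D.obj_outerR_eq hk i htd, ← D.obj_outerR_eq hk i hdom] at hq
  replace hq := hq.trans hle2
  rcases hc with rfl | ⟨k, rfl⟩ | ⟨k, hc⟩ | ⟨-, he⟩
  · refine ⟨i, i, .inl ?_⟩
    have : D.outerBreak i i = 0 := by simp [outerBreak]
    rwa [this]
  · refine ⟨i, k, .inl ?_⟩
    rwa [outerBreak, max_eq_right ht]
  · refine ⟨i, k, .inr ?_⟩
    rwa [outerStat, ← hc, max_eq_right ht]
  · exfalso
    have : D.outerR i t = 0 := by rw [outerR, he]; simp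
    rw [this, obj] at hq
    linarith [D.one_le_gap t (t * D.x i - 1)]

end LZPM

namespace LZPM

/-! ### The inner problem: reduction to finitely many points -/

/-- Mean over the sample points outside of `[x j, x k]`. -/
noncomputable def meanOffIcc (D : LZPM) (j k : Fin D.n) (f : Fin D.n → ℝ) : ℝ :=
  D.mean fun l => if D.x l < D.x j then f l else if D.x k < D.x l then f l else 0

noncomputable def innerDet (D : LZPM) (j k : Fin D.n) : ℝ :=
  (D.meanOffIcc j k fun l => D.x l ^ 2) * (D.meanOffIcc j k fun _ => 1) -
    D.meanOffIcc j k D.x ^ 2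

/-- The stationary point of the piece where `0 < p xₗ - w < 1` exactly on `[x j, x k]`. -/
noncomputable def innerP (D : LZPM) (r : ℝ) (j k : Fin D.n) : ℝ :=
  max 0 (-(r / 2) * (D.coefP * (D.meanOffIcc j k fun _ => 1) + D.coefW * D.meanOffIcc j k D.x) /
    D.innerDet j k)

noncomputable def innerW (D : LZPM) (r : ℝ) (j k : Fin D.n) : ℝ :=
  -(r / 2) * (D.coefP * D.meanOffIcc j k D.x + D.coefW * (D.meanOffIcc j k fun l => D.x l ^ 2)) /
    D.innerDet j k

noncomputable def innerStat (D : LZPM) (r : ℝ) (i k : Fin D.n) : ℝ :=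
  max 0 (D.kinkStat 0 (r * (D.coefP + D.coefW * D.x i)) i k)

theorem exists_inner_kink_le (D : LZPM) {r M : ℝ} (hM : ∀ p w, 0 ≤ p → M ≤ D.obj r p w)
    (i : Fin D.n) {p : ℝ} (hp : 0 ≤ p) :
    ∃ k, D.obj r (D.outerBreak i k) (D.outerBreak i k * D.x i - 1) ≤ D.obj r p (p * D.x i - 1) ∨
      D.obj r (D.innerStat r i k) (D.innerStat r i k * D.x i - 1) ≤ D.obj r p (p * D.x i - 1) := by
  have e : ∀ t, D.obj r t (t * D.x i - 1) = 0 * t ^ 2 + r * (D.coefP + D.coefW * D.x i) * t +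
      (D.kappa * r ^ 2 - r * D.coefW) + D.gap t (t * D.x i - 1) := fun t => by
    unfold obj; ring
  obtain ⟨t, ht, -, hq, hc⟩ := D.exists_kink_le i (M := M) (e := 0) (b := 0)
    (c₂ := 0) (c₁ := r * (D.coefP + D.coefW * D.x i)) (c₀ := D.kappa * r ^ 2 - r * D.coefW)
    (fun t ht _ => by rw [← e]; exact hM t _ ht) hp (by simp)
  rw [← e, ← e] at hq
  rcases hc with rfl | ⟨k, rfl⟩ | ⟨k, hc⟩ | ⟨h0, -⟩
  · refine ⟨i, .inl ?_⟩
    have : D.outerBreak i i = 0 := by simp [outerBreak]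
    rwa [this]
  · refine ⟨k, .inl ?_⟩
    rwa [outerBreak, max_eq_right ht]
  · refine ⟨k, .inr ?_⟩
    rwa [innerStat, ← hc, max_eq_right ht]
  · exact absurd rfl h0

theorem gap_zero (D : LZPM) (w : ℝ) : D.gap 0 w = phi (-w) := by
  unfold gap
  simp only [zero_mul, zero_sub]
  exact D.mean_const _

/-- Among the points with `p = 0`, two suffice. -/
theorem exists_le_of_p_eq_zero (D : LZPM) (r w : ℝ) :
    D.obj r 0 (-(r * D.coefW / 2)) ≤ D.obj r 0 w ∨ D.obj r 0 (-1) ≤ D.obj r 0 w := by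
  unfold obj
  simp only [gap_zero, neg_neg]
  rw [phi_of_one_le (le_refl (1 : ℝ))]
  set u := r * D.coefW / 2 with hu
  have e : ∀ y, r * (D.coefP * 0 + D.coefW * y) = 2 * u * y := fun y => by rw [hu]; ring
  simp only [e]
  -- In z = −w the function is φ(z) − 2 u z plus a constant. It is least at z = u when u ≤ 0 or u ≥
  -- 1, and at the kink z = 1 otherwise.
  by_cases h0 : u ≤ 0
  · left
    rw [phi_of_nonpos h0]
    rcases le_or_gt w 0 with h | h
    · nlinarith [one_le_phi (-w), mul_nonneg (neg_nonneg.2 h) (neg_nonneg.2 h0), sq_nonneg u]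
    · rw [phi_of_nonpos (by linarith)]
      nlinarith [sq_nonneg (w + u)]
  by_cases h1 : u < 1
  · right
    rcases le_or_gt (-w) 1 with h | h
    · nlinarith [one_le_phi (-w)]
    · rw [phi_of_one_le h.le]; nlinarith
  · left
    rw [phi_of_one_le (not_lt.1 h1)]
    nlinarith [sq_le_phi (-w), sq_nonneg (w + u)]

/-! #### Existence of a minimizer -/

theorem continuous_phi : Continuous phi := by
  unfold phi
  refine Continuous.if_le (by fun_prop) ?_ continuous_id continuous_const (by rintro x rfl; simp)
  have : (fun x : ℝ => if x < 1 then (1 : ℝ) else x ^ 2) = fun x => if 1 ≤ x then x ^ 2 else 1 := by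
    funext x
    by_cases h : x < 1
    · rw [if_pos h, if_neg (not_le.2 h)]
    · rw [if_neg h, if_pos (not_lt.1 h)]
  rw [this]
  exact Continuous.if_le (by fun_prop) continuous_const continuous_const continuous_id
    (by rintro x rfl; simp)

theorem continuous_obj (D : LZPM) (r : ℝ) : Continuous fun y : ℝ × ℝ => D.obj r y.1 y.2 := by
  have := continuous_phi
  unfold obj gap mean
  fun_prop

/-- Coercivity: for p > P the term var · p² outweighs slack · r p and the value at the origin, and
for bounded p the square in `obj_ge` bounds w. Compactness of the resulting box does the rest. -/
theorem exists_minimizer (D : LZPM) (hv : 0 < D.var) {r : ℝ} (hr : 0 < r) :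
    ∃ p w, 0 ≤ p ∧ ∀ p' w', 0 ≤ p' → D.obj r p w ≤ D.obj r p' w' := by
  set C := D.obj r 0 0
  set P := (|C| + |D.slack| * r) / D.var + 1 with hP
  have hP1 : 1 ≤ P := by
    have : 0 ≤ (|C| + |D.slack| * r) / D.var := by positivity
    linarith
  set Q := |C| + |D.slack| * r * P with hQ
  have hQ0 : 0 ≤ Q := by positivity
  set W := 1 + Q + |D.mean D.x| * P + r * |D.μ - D.τ| with hW
  have hW0 : 0 ≤ W := by positivity
  have hK : IsCompact (Set.Icc (0 : ℝ) P ×ˢ Set.Icc (-W) W) := isCompact_Icc.prod isCompact_Icc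
  have h00 : ((0 : ℝ), (0 : ℝ)) ∈ Set.Icc (0 : ℝ) P ×ˢ Set.Icc (-W) W :=
    ⟨⟨le_rfl, by linarith⟩, ⟨by simpa using hW0, hW0⟩⟩
  obtain ⟨⟨p, w⟩, hmem, hmin⟩ := hK.exists_isMinOn ⟨_, h00⟩ (D.continuous_obj r).continuousOn
  have hC : D.obj r p w ≤ C := hmin h00
  refine ⟨p, w, hmem.1.1, fun p' w' hp' => ?_⟩
  by_contra! hlt
  have hlt' : D.obj r p' w' < C := hlt.trans_le hC
  have hge := D.obj_ge r p' w'
  have hrp : -(|D.slack| * r * p') ≤ D.slack * (r * p') := by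
    have := mul_le_mul_of_nonneg_right (neg_abs_le D.slack) (mul_nonneg hr.le hp')
    linarith
  have hs := sq_nonneg (w' - D.mean D.x * p' + r * (D.μ - D.τ))
  have hs' := mul_nonneg (sq_nonneg D.σ) (sq_nonneg r)
  have hPv : P * D.var = |C| + |D.slack| * r + D.var := by rw [hP]; field_simp
  have hpP : p' ≤ P := by
    by_contra! h
    have h1 : P * D.var ≤ p' * D.var := mul_le_mul_of_nonneg_right h.le hv.le
    have h2 : 1 ≤ p' := hP1.trans h.le
    have h3 := mul_le_mul_of_nonneg_left (hPv ▸ h1) hp'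
    have h4 := mul_le_mul_of_nonneg_left h2 (abs_nonneg C)
    nlinarith [le_abs_self C, mul_nonneg hp' hv.le]
  have hsq : (w' - D.mean D.x * p' + r * (D.μ - D.τ)) ^ 2 ≤ Q := by
    have h1 := mul_le_mul_of_nonneg_left hpP (mul_nonneg (abs_nonneg D.slack) hr.le)
    have h2 := mul_nonneg hv.le (sq_nonneg p')
    linarith [le_abs_self C]
  have habs : |w' - D.mean D.x * p' + r * (D.μ - D.τ)| ≤ 1 + Q :=
    abs_le_of_sq_le_sq (by nlinarith) (by linarith)
  have hwW : |w'| ≤ W := by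
    have h1 : w' = (w' - D.mean D.x * p' + r * (D.μ - D.τ)) + (D.mean D.x * p' - r * (D.μ - D.τ)) := by
      ring
    have h2 : |D.mean D.x * p'| ≤ |D.mean D.x| * P := by
      rw [abs_mul, abs_of_nonneg hp']
      exact mul_le_mul_of_nonneg_left hpP (abs_nonneg _)
    have h3 : |r * (D.μ - D.τ)| = r * |D.μ - D.τ| := by rw [abs_mul, abs_of_pos hr]
    rw [h1]
    refine (abs_add_le _ _).trans ?_
    have := abs_sub (D.mean D.x * p') (r * (D.μ - D.τ))
    linarith
  have : D.obj r p w ≤ D.obj r p' w' :=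
    hmin (show (p', w') ∈ Set.Icc (0 : ℝ) P ×ˢ Set.Icc (-W) W from ⟨⟨hp', hpP⟩, abs_le.1 hwW⟩)
  linarith

/-! #### Stationarity -/

/-- The derivative of `φ` at points other than `1`. -/
noncomputable def dphi (z : ℝ) : ℝ := if z ≤ 0 then 2 * z else if z < 1 then 0 else 2 * z

/-- A local quadratic upper bound is all that first-order conditions at a minimizer need. It fails
at z = 1, where the one-sided slopes of φ are 0 and 2. -/
theorem eventually_phi_le {z : ℝ} (hz : z ≠ 1) :
    ∀ᶠ h in nhds (0 : ℝ), phi (z + h) ≤ phi z + dphi z * h + h ^ 2 := by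
  have hc : Continuous fun h : ℝ => z + h := by fun_prop
  rcases lt_or_gt_of_ne hz with h1 | h1
  · have : ∀ᶠ h in nhds (0 : ℝ), z + h < 1 := hc.continuousAt.eventually_lt_const (by simpa using h1)
    filter_upwards [this] with h hh
    by_cases h0 : z ≤ 0
    · have := phi_le (z + h)
      rw [phi_of_nonpos h0, dphi, if_pos h0]; linarith
    · rw [phi_of_mem (by linarith) h1.le, dphi, if_neg h0, if_pos h1]
      rcases le_or_gt 0 (z + h) with h2 | h2
      · rw [phi_of_mem h2 hh.le]; nlinarith
      · rw [phi_of_nonpos h2.le]; nlinarith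
  · have : ∀ᶠ h in nhds (0 : ℝ), 1 < z + h := hc.continuousAt.eventually_const_lt (by simpa using h1)
    filter_upwards [this] with h hh
    rw [phi_of_one_le hh.le, phi_of_one_le h1.le, dphi, if_neg (by linarith), if_neg (by linarith)]
    linarith

theorem eq_zero_of_eventually_nonneg {g q : ℝ} (h : ∀ᶠ s in nhds (0 : ℝ), 0 ≤ s * g + s ^ 2 * q) :
    g = 0 := by
  have hd : HasDerivAt (fun s : ℝ => s * g + s ^ 2 * q) g 0 := by
    have := ((hasDerivAt_id' (0 : ℝ)).mul_const g).fun_add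
      (((hasDerivAt_id' (0 : ℝ)).fun_pow 2).mul_const q)
    exact this.congr_deriv (by simp)
  refine IsLocalMin.hasDerivAt_eq_zero ?_ hd
  filter_upwards [h] with s hs
  simpa using hs

/-- Since p > 0, small steps in both senses of (u, v) are feasible. The quadratic upper bound on φ
turns minimality into 0 ≤ s g + s² q near s = 0, which forces g = 0. -/
theorem stationary (D : LZPM) {r p w : ℝ} (hp : 0 < p)
    (hmin : ∀ p' w', 0 ≤ p' → D.obj r p w ≤ D.obj r p' w') (hz : ∀ i, p * D.x i - w ≠ 1) (u v : ℝ) :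
    r * (D.coefP * u + D.coefW * v) +
      D.mean (fun i => dphi (p * D.x i - w) * (u * D.x i - v)) = 0 := by
  apply eq_zero_of_eventually_nonneg (q := D.mean fun i => (u * D.x i - v) ^ 2)
  have h1 : ∀ᶠ s in nhds (0 : ℝ), 0 < p + s * u := by
    have hc : Continuous fun s : ℝ => p + s * u := by fun_prop
    exact hc.continuousAt.eventually_const_lt (by simpa using hp)
  have h2 : ∀ᶠ s in nhds (0 : ℝ), ∀ i, phi (p * D.x i - w + s * (u * D.x i - v)) ≤
      phi (p * D.x i - w) + dphi (p * D.x i - w) * (s * (u * D.x i - v)) + (s * (u * D.x i - v)) ^ 2 := by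
    rw [Filter.eventually_all]
    intro i
    have hc : Filter.Tendsto (fun s : ℝ => s * (u * D.x i - v)) (nhds 0) (nhds 0) := by
      have : Continuous fun s : ℝ => s * (u * D.x i - v) := by fun_prop
      simpa using this.tendsto 0
    exact hc.eventually (eventually_phi_le (hz i))
  filter_upwards [h1, h2] with s hs1 hs2
  have h3 := hmin (p + s * u) (w + s * v) hs1.le
  have h4 : D.gap (p + s * u) (w + s * v) ≤ D.gap p w +
      s * D.mean (fun i => dphi (p * D.x i - w) * (u * D.x i - v)) +
      s ^ 2 * D.mean (fun i => (u * D.x i - v) ^ 2) := by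
    rw [gap, gap, ← mean_mul, ← mean_mul, ← mean_add, ← mean_add]
    refine D.mean_le fun i => ?_
    rw [show (p + s * u) * D.x i - (w + s * v) = p * D.x i - w + s * (u * D.x i - v) by ring]
    linarith [hs2 i]
  unfold obj at h3
  linarith

/-- The indices where `φ` is locally constant form an interval of sample points. -/
theorem exists_interval (D : LZPM) {p : ℝ} (hp : 0 < p) (w : ℝ) (hx : ∃ i j, D.x i ≠ D.x j) :
    ∃ j k, ∀ l, (0 < p * D.x l - w ∧ p * D.x l - w < 1) ↔ (¬ D.x l < D.x j ∧ ¬ D.x k < D.x l) := by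
  classical
  set B := Finset.univ.filter fun l => 0 < p * D.x l - w ∧ p * D.x l - w < 1 with hB
  by_cases hne : B.Nonempty
  · obtain ⟨j, hj, hmin⟩ := B.exists_min_image D.x hne
    obtain ⟨k, hk, hmax⟩ := B.exists_max_image D.x hne
    simp only [hB, Finset.mem_filter, Finset.mem_univ, true_and] at hj hk hmin hmax
    refine ⟨j, k, fun l => ⟨fun h => ⟨not_lt.2 (hmin l h), not_lt.2 (hmax l h)⟩, fun h => ?_⟩⟩
    have h1 := mul_le_mul_of_nonneg_left (not_lt.1 h.1) hp.le
    have h2 := mul_le_mul_of_nonneg_left (not_lt.1 h.2) hp.le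
    exact ⟨by linarith [hj.1], by linarith [hk.2]⟩
  · obtain ⟨j, k, hjk⟩ : ∃ j k, D.x k < D.x j := by
      obtain ⟨i, j, hij⟩ := hx
      rcases lt_or_gt_of_ne hij with h | h
      · exact ⟨j, i, h⟩
      · exact ⟨i, j, h⟩
    refine ⟨j, k, fun l => ⟨fun h => absurd ⟨l, by simpa [hB] using h⟩ hne, fun h => ?_⟩⟩
    exact absurd hjk (not_lt.2 ((not_lt.1 h.1).trans (not_lt.1 h.2)))

theorem dphi_eq (z : ℝ) : dphi z = if 0 < z ∧ z < 1 then 0 else 2 * z := by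
  unfold dphi
  by_cases h : z ≤ 0
  · rw [if_pos h, if_neg fun h' => absurd h'.1 (not_lt.2 h)]
  · simp only [h, if_false, not_le.1 h, true_and]

/-- A minimizer with two different active sample values solves a regular linear system. -/
theorem eq_inner_of_stationary (D : LZPM) {r p w : ℝ} (hp : 0 < p)
    (hmin : ∀ p' w', 0 ≤ p' → D.obj r p w ≤ D.obj r p' w') (hz : ∀ i, p * D.x i - w ≠ 1)
    {i₁ i₂ : Fin D.n} (h1 : ¬ (0 < p * D.x i₁ - w ∧ p * D.x i₁ - w < 1))
    (h2 : ¬ (0 < p * D.x i₂ - w ∧ p * D.x i₂ - w < 1)) (hx : D.x i₁ ≠ D.x i₂) :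
    ∃ j k, p = D.innerP r j k ∧ w = D.innerW r j k := by
  obtain ⟨j, k, hjk⟩ := D.exists_interval hp w ⟨i₁, i₂, hx⟩
  refine ⟨j, k, ?_⟩
  have hoff : ∀ (f : Fin D.n → ℝ), D.meanOffIcc j k f =
      D.mean fun l => if 0 < p * D.x l - w ∧ p * D.x l - w < 1 then 0 else f l := by
    intro f
    refine D.mean_congr fun l => ?_
    simp only [hjk l]
    by_cases h1 : D.x l < D.x j <;> by_cases h2 : D.x k < D.x l <;> simp [h1, h2]
  set N := D.meanOffIcc j k fun _ => 1 with hN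
  set S₁ := D.meanOffIcc j k D.x with hS₁
  set S₂ := D.meanOffIcc j k fun l => D.x l ^ 2 with hS₂
  have hdphi : ∀ u v : ℝ, D.mean (fun i => dphi (p * D.x i - w) * (u * D.x i - v)) =
      2 * p * u * S₂ - (2 * p * v + 2 * w * u) * S₁ + 2 * w * v * N := by
    intro u v
    rw [hN, hS₁, hS₂, hoff, hoff, hoff, ← mean_mul, ← mean_mul, ← mean_mul, ← mean_sub, ← mean_add]
    refine D.mean_congr fun l => ?_
    rw [dphi_eq]
    split_ifs <;> ring
  have g1 := D.stationary hp hmin hz 1 0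
  have g2 := D.stationary hp hmin hz 0 1
  rw [hdphi] at g1 g2
  have hNpos : ∀ i, ¬ (0 < p * D.x i - w ∧ p * D.x i - w < 1) → 0 < N := by
    intro i hi
    rw [hN, hoff, mean]
    refine mul_pos (by have := D.n_pos_real; positivity) (Finset.sum_pos' (fun l _ => ?_) ⟨i, Finset.mem_univ i, ?_⟩)
    · split_ifs <;> norm_num
    · rw [if_neg hi]; norm_num
  -- Equality case of Cauchy–Schwarz: a vanishing determinant would make all active sample values
  -- equal.
  have hdet : D.innerDet j k ≠ 0 := by
    intro h0
    have hd : S₂ * N - S₁ ^ 2 = 0 := h0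
    have hsum : D.mean (fun l => if 0 < p * D.x l - w ∧ p * D.x l - w < 1 then 0 else (N * D.x l - S₁) ^ 2) = 0 := by
      have : D.mean (fun l => if 0 < p * D.x l - w ∧ p * D.x l - w < 1 then 0 else (N * D.x l - S₁) ^ 2) =
          N ^ 2 * S₂ - 2 * N * S₁ * S₁ + S₁ ^ 2 * N := by
        conv_rhs => rw [hS₂]
        conv_rhs => arg 1; arg 2; arg 2; rw [hS₁]
        conv_rhs => arg 2; arg 2; rw [hN]
        rw [hoff, hoff, hoff, ← mean_mul, ← mean_mul, ← mean_mul, ← mean_sub, ← mean_add]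
        refine D.mean_congr fun l => ?_
        split_ifs <;> ring
      rw [this]; linear_combination N * hd
    have hall : ∀ i, ¬ (0 < p * D.x i - w ∧ p * D.x i - w < 1) → N * D.x i = S₁ := by
      intro i hi
      rw [mean, mul_eq_zero] at hsum
      have hsum := hsum.resolve_left (by have := D.n_pos_real; positivity)
      rw [Finset.sum_eq_zero_iff_of_nonneg (fun l _ => by split_ifs <;> positivity)] at hsum
      have := hsum i (Finset.mem_univ i)
      rw [if_neg hi] at this
      linarith [pow_eq_zero_iff (two_ne_zero) |>.1 this]
    exact hx (mul_left_cancel₀ (hNpos i₁ h1).ne' ((hall i₁ h1).trans (hall i₂ h2).symm))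
  have hdd : D.innerDet j k = S₂ * N - S₁ ^ 2 := rfl
  constructor
  · rw [innerP, max_eq_right]
    · rw [eq_div_iff hdet, hdd]
      linear_combination (N / 2) * g1 + (S₁ / 2) * g2
    · suffices p = -(r / 2) * (D.coefP * N + D.coefW * S₁) / D.innerDet j k from this ▸ hp.le
      rw [eq_div_iff hdet, hdd]
      linear_combination (N / 2) * g1 + (S₁ / 2) * g2
  · rw [innerW, eq_div_iff hdet, hdd]
    linear_combination (S₁ / 2) * g1 + (S₂ / 2) * g2

/-- A degenerate minimizer can be moved to a line `w = p xᵢ - 1` or to `p = 0` at no loss. -/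
theorem exists_kink_of_degenerate (D : LZPM) (hx : ∃ i j, D.x i ≠ D.x j) {r p w : ℝ} (hp : 0 < p)
    (hmin : ∀ p' w', 0 ≤ p' → D.obj r p w ≤ D.obj r p' w') (hz : ∀ i, p * D.x i - w ≠ 1)
    (hdeg : ∀ i₁ i₂, ¬ (0 < p * D.x i₁ - w ∧ p * D.x i₁ - w < 1) →
      ¬ (0 < p * D.x i₂ - w ∧ p * D.x i₂ - w < 1) → D.x i₁ = D.x i₂) :
    ∃ i p', 0 ≤ p' ∧ D.obj r p' (p' * D.x i - 1) ≤ D.obj r p w := by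
  classical
  by_cases hall : ∀ i, 0 < p * D.x i - w ∧ p * D.x i - w < 1
  · have h0 : ∀ u v, D.mean (fun i => dphi (p * D.x i - w) * (u * D.x i - v)) = 0 := by
      intro u v
      rw [← D.mean_const 0]
      refine D.mean_congr fun i => ?_
      rw [dphi_eq, if_pos (hall i), zero_mul]
    have g1 := D.stationary hp hmin hz 1 0
    have g2 := D.stationary hp hmin hz 0 1
    rw [h0] at g1 g2
    -- All points are on the flat part of φ, so both linear coefficients vanish, and p = 0, w = −1
    -- also gives `gap` = 1.
    refine ⟨⟨0, D.n_pos⟩, 0, le_rfl, ?_⟩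
    have h1 := D.one_le_gap p w
    unfold obj
    rw [zero_mul, gap_zero, phi_of_mem (by norm_num) (by norm_num)]
    have e1 : r * (D.coefP * p + D.coefW * w) = 0 := by linear_combination p * g1 + w * g2
    have e2 : r * (D.coefP * 0 + D.coefW * (0 - 1)) = 0 := by linear_combination -g2
    linarith
  push Not at hall
  obtain ⟨o, ho⟩ := hall
  replace ho : ¬ (0 < p * D.x o - w ∧ p * D.x o - w < 1) := fun h => absurd (ho h.1) (not_le.2 h.2)
  set B := Finset.univ.filter fun l => 0 < p * D.x l - w ∧ p * D.x l - w < 1 with hB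
  have hBne : B.Nonempty := by
    obtain ⟨i, j, hij⟩ := hx
    by_contra hne
    have : ∀ l, ¬ (0 < p * D.x l - w ∧ p * D.x l - w < 1) := fun l h =>
      hne ⟨l, by simpa [hB] using h⟩
    exact hij (hdeg i j (this i) (this j))
  obtain ⟨j, hj, hmax⟩ := B.exists_max_image D.x hBne
  simp only [hB, Finset.mem_filter, Finset.mem_univ, true_and] at hj hmax
  set c := D.x o with hc
  set y := p * c - w with hy
  have hjc : D.x j - c ≠ 0 := by
    intro h
    rw [sub_eq_zero.1 h] at hj
    exact ho hj
  -- Rotate about the single active value c, keeping p c − w = y, until the flat point with the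
  -- greatest sample value reaches 1. It is the first to do so, whether y ≤ 0 and p grows or y > 1
  -- and p shrinks.
  set p' := (1 - y) / (D.x j - c) with hp'
  have hpj : p' * (D.x j - c) = 1 - y := div_mul_cancel₀ _ hjc
  have hzl : ∀ l, p * D.x l - w = y + p * (D.x l - c) := fun l => by rw [hy]; ring
  rw [hzl] at hj
  have hy1 : y ≠ 1 := hz o
  have hdiff : (p' - p) * (D.x j - c) > 0 := by linarith [hj.2]
  have hcases : (y ≤ 0 ∧ 0 < D.x j - c) ∨ (1 < y ∧ D.x j - c < 0) := by
    rcases le_or_gt y 0 with h | h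
    · exact .inl ⟨h, by by_contra h'; nlinarith [hj.1]⟩
    · have : 1 < y := lt_of_le_of_ne (not_lt.1 fun h' => ho ⟨h, h'⟩) hy1.symm
      exact .inr ⟨this, by by_contra h'; nlinarith [hj.2]⟩
  have hp'0 : 0 ≤ p' := by
    rcases hcases with ⟨h1, h2⟩ | ⟨h1, h2⟩
    · exact div_nonneg (by linarith) h2.le
    · exact div_nonneg_of_nonpos (by linarith) h2.le
  refine ⟨j, p', hp'0, le_of_eq ?_⟩
  have hw' : p' * D.x j - 1 = p' * c - y := by linarith
  rw [hw']
  have hgap : D.gap p' (p' * c - y) = D.gap p w := by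
    refine D.mean_congr fun l => ?_
    rw [show p' * D.x l - (p' * c - y) = y + p' * (D.x l - c) by ring, hzl]
    by_cases hl : 0 < p * D.x l - w ∧ p * D.x l - w < 1
    · have hle := hmax l hl
      rw [hzl] at hl
      rw [phi_of_mem hl.1.le hl.2.le, phi_of_mem]
      · rcases hcases with ⟨h1, h2⟩ | ⟨h1, h2⟩
        · have h3 : 0 < p' - p := by by_contra h; nlinarith
          have h4 : 0 < D.x l - c := by by_contra h; nlinarith [hl.1]
          nlinarith [hl.1]
        · have h3 : p' - p < 0 := by by_contra h; nlinarith
          have h4 : D.x l - c < 0 := by linarith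
          nlinarith [hl.1]
      · nlinarith
    · have : D.x l - c = 0 := sub_eq_zero.2 (hdeg l o hl ho)
      rw [this, mul_zero, mul_zero]
  -- The rotation moves in direction (1, c). Flat points have zero derivative and active ones do not
  -- move, so the linear part is constant as well.
  have g := D.stationary hp hmin hz 1 c
  have hzero : D.mean (fun i => dphi (p * D.x i - w) * (1 * D.x i - c)) = 0 := by
    rw [← D.mean_const 0]
    refine D.mean_congr fun l => ?_
    by_cases hl : 0 < p * D.x l - w ∧ p * D.x l - w < 1
    · rw [dphi_eq, if_pos hl, zero_mul]
    · rw [hdeg l o hl ho]; ring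
  rw [hzero] at g
  unfold obj
  rw [hgap]
  have : w = p * c - y := by rw [hy]; ring
  rw [this]
  linear_combination (p' - p) * g

theorem exists_ne_of_var_pos (D : LZPM) (hv : 0 < D.var) : ∃ i j, D.x i ≠ D.x j := by
  by_contra! h
  have h1 : ∀ i, D.x i = D.mean D.x := fun i => by
    rw [← D.mean_const (D.x i)]
    exact D.mean_congr fun j => h i j
  have : D.var = 0 := by
    unfold var
    rw [← D.mean_const 0]
    exact D.mean_congr fun i => by rw [h1 i]; ring
  linarith

/-- If the inner problem is bounded, one of the candidates of some index pair is optimal. -/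
theorem exists_inner_le (D : LZPM) (h : 0 < D.var ∨ 0 ≤ D.slack) {r : ℝ} (hr : 0 < r) {p : ℝ}
    (hp : 0 ≤ p) (w : ℝ) :
    ∃ j k, D.obj r 0 (-(r * D.coefW / 2)) ≤ D.obj r p w ∨
      D.obj r (D.outerBreak j k) (D.outerBreak j k * D.x j - 1) ≤ D.obj r p w ∨
      D.obj r (D.innerStat r j k) (D.innerStat r j k * D.x j - 1) ≤ D.obj r p w ∨
      D.obj r (D.innerP r j k) (D.innerW r j k) ≤ D.obj r p w := by
  have zero : ∀ w', D.obj r 0 w' ≤ D.obj r p w → ∃ j k, D.obj r 0 (-(r * D.coefW / 2)) ≤ D.obj r p w ∨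
      D.obj r (D.outerBreak j k) (D.outerBreak j k * D.x j - 1) ≤ D.obj r p w ∨
      D.obj r (D.innerStat r j k) (D.innerStat r j k * D.x j - 1) ≤ D.obj r p w ∨
      D.obj r (D.innerP r j k) (D.innerW r j k) ≤ D.obj r p w := by
    intro w' hw'
    refine ⟨⟨0, D.n_pos⟩, ⟨0, D.n_pos⟩, ?_⟩
    rcases D.exists_le_of_p_eq_zero r w' with h1 | h1
    · exact .inl (h1.trans hw')
    · refine .inr (.inl ?_)
      simp only [outerBreak, sub_self, div_zero, max_self, zero_mul, zero_sub]
      exact h1.trans hw'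
  rcases D.var_nonneg.eq_or_lt with hv | hv
  · have hs : 0 ≤ D.slack := h.resolve_left (by linarith)
    -- All samples coincide. Moving to p = 0 with the same p xᵢ − w changes only the term slack · r
    -- p, which is nonnegative.
    refine zero (-(p * D.mean D.x - w)) ?_
    have hx : ∀ i, D.x i = D.mean D.x := by
      intro i
      have h0 : D.var = 0 := hv.symm
      rw [var, mean, mul_eq_zero] at h0
      have h0 := h0.resolve_left (by have := D.n_pos_real; positivity)
      rw [Finset.sum_eq_zero_iff_of_nonneg (fun l _ => sq_nonneg _)] at h0
      linarith [pow_eq_zero_iff (two_ne_zero) |>.1 (h0 i (Finset.mem_univ i))]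
    rw [obj_eq, obj_eq]
    have e : D.mean (fun i => phi (0 * D.x i - -(p * D.mean D.x - w)) -
        (0 * D.x i - -(p * D.mean D.x - w)) ^ 2) =
        D.mean (fun i => phi (p * D.x i - w) - (p * D.x i - w) ^ 2) := by
      refine D.mean_congr fun i => ?_
      rw [hx i, show 0 * D.mean D.x - -(p * D.mean D.x - w) = p * D.mean D.x - w by ring]
    rw [e, ← hv]
    nlinarith [mul_nonneg hs (mul_nonneg hr.le hp)]
  · obtain ⟨q, y, hq, hmin⟩ := D.exists_minimizer hv hr
    have hle := hmin p w hp
    have kink : ∀ i p', 0 ≤ p' → D.obj r p' (p' * D.x i - 1) ≤ D.obj r q y →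
        ∃ j k, D.obj r 0 (-(r * D.coefW / 2)) ≤ D.obj r p w ∨
        D.obj r (D.outerBreak j k) (D.outerBreak j k * D.x j - 1) ≤ D.obj r p w ∨
        D.obj r (D.innerStat r j k) (D.innerStat r j k * D.x j - 1) ≤ D.obj r p w ∨
        D.obj r (D.innerP r j k) (D.innerW r j k) ≤ D.obj r p w := by
      intro i p' hp' hk
      obtain ⟨k, h1 | h1⟩ := D.exists_inner_kink_le hmin i hp'
      · exact ⟨i, k, .inr (.inl (h1.trans (hk.trans hle)))⟩
      · exact ⟨i, k, .inr (.inr (.inl (h1.trans (hk.trans hle))))⟩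
    rcases hq.eq_or_lt with rfl | hq0
    · exact zero y hle
    by_cases hz : ∃ i, q * D.x i - y = 1
    · obtain ⟨i, hi⟩ := hz
      refine kink i q hq (le_of_eq ?_)
      rw [show q * D.x i - 1 = y by linarith]
    push Not at hz
    by_cases hdeg : ∀ i₁ i₂, ¬ (0 < q * D.x i₁ - y ∧ q * D.x i₁ - y < 1) →
      ¬ (0 < q * D.x i₂ - y ∧ q * D.x i₂ - y < 1) → D.x i₁ = D.x i₂
    · obtain ⟨i, p', hp', hk⟩ :=
        D.exists_kink_of_degenerate (D.exists_ne_of_var_pos hv) hq0 hmin hz hdeg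
      exact kink i p' hp' hk
    · simp only [not_forall] at hdeg
      obtain ⟨i₁, i₂, h1, h2, h3⟩ := hdeg
      obtain ⟨j, k, rfl, rfl⟩ := D.eq_inner_of_stationary hq0 hmin hz h1 h2 h3
      exact ⟨j, k, .inr (.inr (.inr hle))⟩

end LZPM

namespace LZPM

open RealRAM

/-! ### Programs for the quantities that define the candidates -/

namespace Comp

variable {base : ℕ}

theorem ofNat (q : ℕ) : Comp base fun _ => (q : ℝ) := by
  simpa using Comp.const (base := base) (q : ℚ)

theorem zero : Comp base fun _ => (0 : ℝ) := by simpa using Comp.ofNat (base := base) 0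

theorem one : Comp base fun _ => (1 : ℝ) := by simpa using Comp.ofNat (base := base) 1

theorem two : Comp base fun _ => (2 : ℝ) := by simpa using Comp.ofNat (base := base) 2

theorem neg (hb : base ≤ 5) {f : Ctx → ℝ} (hf : Comp base f) : Comp base fun c => -f c := by
  simpa only [zero_sub] using Comp.zero.sub hb hf

theorem mean (hb : base ≤ 5) (v : ℕ) {f : Ctx → ℝ} (hf : Comp base f)
    {g : (c : Ctx) → Fin c.D.n → ℝ} (hg : ∀ c l, f (c.bind v l) = g c l) :
    Comp base fun c => c.D.mean (g c) := by
  have h1 : Comp base fun c => ∑ i : Fin c.D.n, (1 : ℝ) := Comp.one.sum hb v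
  simp only [Finset.sum_const, Finset.card_univ, Fintype.card_fin, nsmul_eq_mul, mul_one] at h1
  have h2 : Comp base fun c => ∑ l, f (c.bind v l) := hf.sum hb v
  simp only [hg] at h2
  exact (Comp.one.div hb h1).mul hb h2

theorem meanSample (hb : base ≤ 5) : Comp base fun c => c.D.mean c.D.x :=
  Comp.mean hb 2 (Comp.sample 2) (g := fun c l => c.D.x l) fun c l => by simp [Ctx.bind]

theorem var (hb : base ≤ 5) : Comp base fun c => c.D.var :=
  Comp.mean hb 2 (((Comp.sample 2).sub hb (Comp.meanSample hb)).sq hb) fun c l => by simp [Ctx.bind]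

theorem slack (hb : base ≤ 5) : Comp base fun c => c.D.slack :=
  ((Comp.radius.sub hb (Comp.deviation.sq hb)).sub hb (Comp.var hb)).sub hb
    ((Comp.expect.sub hb (Comp.meanSample hb)).sq hb)

theorem kappa (hb : base ≤ 5) : Comp base fun c => c.D.kappa :=
  (Comp.deviation.sq hb).add hb ((Comp.expect.sub hb Comp.threshold).sq hb)

theorem coefW (hb : base ≤ 5) : Comp base fun c => c.D.coefW :=
  Comp.two.mul hb (Comp.expect.sub hb Comp.threshold)

theorem coefP (hb : base ≤ 5) : Comp base fun c => c.D.coefP := by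
  have h : Comp base fun c => c.D.mean fun i => c.D.x i ^ 2 :=
    Comp.mean hb 2 ((Comp.sample 2).sq hb) fun c l => by simp [Ctx.bind]
  exact ((Comp.radius.sub hb ((Comp.deviation.sq hb).add hb (Comp.expect.sq hb))).sub hb h).add hb
    ((Comp.two.mul hb Comp.threshold).mul hb (Comp.meanSample hb))

theorem meanOffIco (hb : base ≤ 5) {f : Ctx → ℝ} (hf : Comp base f)
    {g : (c : Ctx) → Fin c.D.n → ℝ} (hg : ∀ c l, f (c.bind 2 l) = g c l) :
    Comp base fun c => c.D.meanOffIco (c.env 1) (c.env 0) (g c) :=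
  Comp.mean hb 2 ((Comp.sample 2).ite_lt hb (Comp.sample 1) hf
    ((Comp.sample 2).ite_lt hb (Comp.sample 0) Comp.zero hf)) fun c l => by
      rw [hg]; simp [Ctx.bind]

theorem meanOffIcc (hb : base ≤ 5) {f : Ctx → ℝ} (hf : Comp base f)
    {g : (c : Ctx) → Fin c.D.n → ℝ} (hg : ∀ c l, f (c.bind 2 l) = g c l) :
    Comp base fun c => c.D.meanOffIcc (c.env 0) (c.env 1) (g c) :=
  Comp.mean hb 2 ((Comp.sample 2).ite_lt hb (Comp.sample 0) hf
    ((Comp.sample 1).ite_lt hb (Comp.sample 2) hf Comp.zero)) fun c l => by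
      rw [hg]; simp [Ctx.bind]

theorem kinkStat (hb : base ≤ 5) {f g : Ctx → ℝ} (hf : Comp base f) (hg : Comp base g) :
    Comp base fun c => c.D.kinkStat (f c) (g c) (c.env 0) (c.env 1) := by
  have h1 : Comp base fun c => c.D.meanOffIco (c.env 1) (c.env 0) fun l => c.D.x l - c.D.x (c.env 0) :=
    Comp.meanOffIco hb ((Comp.sample 2).sub hb (Comp.sample 0)) fun c l => by simp [Ctx.bind]
  have h2 : Comp base fun c => c.D.meanOffIco (c.env 1) (c.env 0) fun l =>
      (c.D.x l - c.D.x (c.env 0)) ^ 2 :=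
    Comp.meanOffIco hb (((Comp.sample 2).sub hb (Comp.sample 0)).sq hb) fun c l => by simp [Ctx.bind]
  exact ((hg.add hb (Comp.two.mul hb h1)).neg hb).div hb (Comp.two.mul hb (hf.add hb h2))

theorem phi (hb : base ≤ 5) {f : Ctx → ℝ} (hf : Comp base f) : Comp base fun c => phi (f c) :=
  hf.ite_le hb Comp.zero (Comp.one.add hb (hf.sq hb)) (hf.ite_lt hb Comp.one Comp.one (hf.sq hb))

/-- The slope of the linear term on the line `w = p xᵢ - 1`. -/
theorem kinkSlope (hb : base ≤ 5) : Comp base fun c => c.D.coefP + c.D.coefW * c.D.x (c.env 0) :=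
  (Comp.coefP hb).add hb ((Comp.coefW hb).mul hb (Comp.sample 0))

theorem outerBreak (hb : base ≤ 5) : Comp base fun c => c.D.outerBreak (c.env 0) (c.env 1) :=
  Comp.zero.max hb ((Comp.one.neg hb).div hb ((Comp.sample 1).sub hb (Comp.sample 0)))

theorem outerStat (hb : base ≤ 5) : Comp base fun c => c.D.outerStat (c.env 0) (c.env 1) := by
  have h4 : Comp base fun c => 4 * c.D.kappa := by
    simpa using (Comp.ofNat (base := base) 4).mul hb (Comp.kappa hb)
  exact Comp.zero.max hb (Comp.kinkStat hb ((((Comp.kinkSlope hb).sq hb).div hb h4).neg hb)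
    (((Comp.two.mul hb (Comp.coefW hb)).mul hb (Comp.kinkSlope hb)).div hb h4))

theorem outerR (hb : base ≤ 5) {f : Ctx → ℝ} (hf : Comp base f) :
    Comp base fun c => c.D.outerR (c.env 0) (f c) :=
  Comp.zero.max hb (((Comp.coefW hb).sub hb ((Comp.kinkSlope hb).mul hb hf)).div hb
    (Comp.two.mul hb (Comp.kappa hb)))

theorem innerStat (hb : base ≤ 5) {f : Ctx → ℝ} (hf : Comp base f) :
    Comp base fun c => c.D.innerStat (f c) (c.env 0) (c.env 1) :=
  Comp.zero.max hb (Comp.kinkStat hb Comp.zero (hf.mul hb (Comp.kinkSlope hb)))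

theorem meanOffIcc_one (hb : base ≤ 5) :
    Comp base fun c => c.D.meanOffIcc (c.env 0) (c.env 1) fun _ => 1 :=
  Comp.meanOffIcc hb Comp.one fun _ _ => rfl

theorem meanOffIcc_sample (hb : base ≤ 5) :
    Comp base fun c => c.D.meanOffIcc (c.env 0) (c.env 1) c.D.x :=
  Comp.meanOffIcc hb (Comp.sample 2) (g := fun c l => c.D.x l) fun c l => by simp [Ctx.bind]

theorem meanOffIcc_sq (hb : base ≤ 5) :
    Comp base fun c => c.D.meanOffIcc (c.env 0) (c.env 1) fun l => c.D.x l ^ 2 :=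
  Comp.meanOffIcc hb ((Comp.sample 2).sq hb) fun c l => by simp [Ctx.bind]

theorem innerDet (hb : base ≤ 5) : Comp base fun c => c.D.innerDet (c.env 0) (c.env 1) :=
  ((Comp.meanOffIcc_sq hb).mul hb (Comp.meanOffIcc_one hb)).sub hb ((Comp.meanOffIcc_sample hb).sq hb)

theorem innerP (hb : base ≤ 5) {f : Ctx → ℝ} (hf : Comp base f) :
    Comp base fun c => c.D.innerP (f c) (c.env 0) (c.env 1) :=
  Comp.zero.max hb ((((hf.div hb Comp.two).neg hb).mul hb
    (((Comp.coefP hb).mul hb (Comp.meanOffIcc_one hb)).add hb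
      ((Comp.coefW hb).mul hb (Comp.meanOffIcc_sample hb)))).div hb (Comp.innerDet hb))

theorem innerW (hb : base ≤ 5) {f : Ctx → ℝ} (hf : Comp base f) :
    Comp base fun c => c.D.innerW (f c) (c.env 0) (c.env 1) :=
  (((hf.div hb Comp.two).neg hb).mul hb
    (((Comp.coefP hb).mul hb (Comp.meanOffIcc_sample hb)).add hb
      ((Comp.coefW hb).mul hb (Comp.meanOffIcc_sq hb)))).div hb (Comp.innerDet hb)

end Comp

/-! ### Computable points -/

/-- The objective at a point `(r, p, w)` depending on the context. -/
noncomputable def value (u : Ctx → ℝ × ℝ × ℝ) (c : Ctx) : ℝ :=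
  c.D.obj (u c).1 (u c).2.1 (u c).2.2

/-- A computable point; loop variable `2` is reserved for sums. -/
structure CompPoint (base : ℕ) (u : Ctx → ℝ × ℝ × ℝ) : Prop where
  r : Comp base fun c => (u c).1
  p : Comp base fun c => (u c).2.1
  w : Comp base fun c => (u c).2.2
  fresh : ∀ c l, u (c.bind 2 l) = u c

namespace CompPoint

variable {base : ℕ} {u v : Ctx → ℝ × ℝ × ℝ}

theorem value (hb : base ≤ 5) (hu : CompPoint base u) : Comp base (value u) := by
  have h : Comp base fun c => c.D.gap (u c).2.1 (u c).2.2 :=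
    Comp.mean hb 2 (((hu.p.mul hb (Comp.sample 2)).sub hb hu.w).phi hb) fun c l => by
      simp only [hu.fresh]; simp [Ctx.bind]
  exact (((Comp.kappa hb).mul hb (hu.r.sq hb)).add hb (hu.r.mul hb
    (((Comp.coefP hb).mul hb hu.p).add hb ((Comp.coefW hb).mul hb hu.w)))).add hb h

theorem value_fresh (hu : CompPoint base u) (c : Ctx) (l : Fin c.D.n) :
    LZPM.value u (c.bind 2 l) = LZPM.value u c := by
  unfold LZPM.value; rw [hu.fresh]; rfl

end CompPoint

/-- The better one of two points. -/
noncomputable def better (u v : Ctx → ℝ × ℝ × ℝ) (c : Ctx) : ℝ × ℝ × ℝ :=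
  if value u c < value v c then u c else v c

theorem value_better_le_left (u v : Ctx → ℝ × ℝ × ℝ) (c : Ctx) : value (better u v) c ≤ value u c := by
  by_cases h : value u c < value v c
  · rw [value, better, if_pos h]; exact le_rfl
  · rw [value, better, if_neg h]; exact not_lt.1 h

theorem value_better_le_right (u v : Ctx → ℝ × ℝ × ℝ) (c : Ctx) : value (better u v) c ≤ value v c := by
  by_cases h : value u c < value v c
  · rw [value, better, if_pos h]; exact h.le
  · rw [value, better, if_neg h]; exact le_rfl

theorem CompPoint.better {base : ℕ} (hb : base ≤ 5) {u v : Ctx → ℝ × ℝ × ℝ} (hu : CompPoint base u)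
    (hv : CompPoint base v) : CompPoint base (better u v) := by
  refine ⟨?_, ?_, ?_, fun c l => ?_⟩
  · simpa only [LZPM.better, apply_ite] using (hu.value hb).ite_lt hb (hv.value hb) hu.r hv.r
  · simpa only [LZPM.better, apply_ite] using (hu.value hb).ite_lt hb (hv.value hb) hu.p hv.p
  · simpa only [LZPM.better, apply_ite] using (hu.value hb).ite_lt hb (hv.value hb) hu.w hv.w
  · simp only [LZPM.better, hu.value_fresh, hv.value_fresh, hu.fresh, hv.fresh]

/-- The best point over all values of the loop variable `k`. -/
noncomputable def minimize (k : ℕ) (u : Ctx → ℝ × ℝ × ℝ) (c : Ctx) : ℝ × ℝ × ℝ :=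
  u (c.bindMin k (value u))

theorem value_minimize_le (k : ℕ) (u : Ctx → ℝ × ℝ × ℝ) (c : Ctx) (i : Fin c.D.n) :
    value (minimize k u) c ≤ value u (c.bind k i) :=
  c.D.argmin_le (fun i => value u (c.bind k i)) i

theorem Ctx.bind_comm (c : Ctx) {v k : ℕ} (h : v ≠ k) (i j : Fin c.D.n) :
    (c.bind v i).bind k j = (c.bind k j).bind v i := by
  simp only [Ctx.bind]
  congr 1
  exact Function.update_comm h _ _ _

/-- Freshness survives because assigning variable 2 commutes with assigning k ≠ 2 and does not
affect the keys, hence not the argmin. -/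
theorem CompPoint.minimize {base : ℕ} (hb : base ≤ 5) {k : ℕ} (hk : k ≠ 2) {u : Ctx → ℝ × ℝ × ℝ}
    (hu : CompPoint base u) : CompPoint base (minimize k u) := by
  refine ⟨(hu.value hb).bindMin hb k hu.r, (hu.value hb).bindMin hb k hu.p,
    (hu.value hb).bindMin hb k hu.w, fun c l => ?_⟩
  unfold LZPM.minimize Ctx.bindMin
  have e : (fun i : Fin c.D.n => LZPM.value u ((c.bind 2 l).bind k i)) =
      fun i : Fin c.D.n => LZPM.value u (c.bind k i) := by
    funext i
    exact (congrArg (LZPM.value u) (Ctx.bind_comm c hk.symm l i)).trans (hu.value_fresh (c.bind k i) l)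
  have e' : (c.bind 2 l).D.argmin (fun i => LZPM.value u ((c.bind 2 l).bind k i)) =
      c.D.argmin fun i : Fin c.D.n => LZPM.value u (c.bind k i) := congrArg c.D.argmin e
  rw [e']
  refine (congrArg u (Ctx.bind_comm c hk.symm l _)).trans ?_
  exact hu.fresh (c.bind k _) l

/-! ### The algorithm for fixed `ξ` -/

noncomputable def innerCandidate (c : Ctx) : ℝ × ℝ × ℝ :=
  better (better (fun c => (√c.ξ, 0, -(√c.ξ * c.D.coefW / 2)))
    fun c => (√c.ξ, c.D.outerBreak (c.env 0) (c.env 1),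
      c.D.outerBreak (c.env 0) (c.env 1) * c.D.x (c.env 0) - 1))
    (better (fun c => (√c.ξ, c.D.innerStat √c.ξ (c.env 0) (c.env 1),
        c.D.innerStat √c.ξ (c.env 0) (c.env 1) * c.D.x (c.env 0) - 1))
      fun c => (√c.ξ, c.D.innerP √c.ξ (c.env 0) (c.env 1), c.D.innerW √c.ξ (c.env 0) (c.env 1))) c

theorem compPoint_innerCandidate : CompPoint 5 innerCandidate := by
  have hb : 5 ≤ 5 := le_rfl
  have hr : Comp 5 fun c => √c.ξ := Comp.level.sqrt hb
  refine CompPoint.better hb (CompPoint.better hb ?_ ?_) (CompPoint.better hb ?_ ?_)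
  · exact ⟨hr, Comp.zero, ((hr.mul hb (Comp.coefW hb)).div hb Comp.two).neg hb, fun c l => rfl⟩
  · exact ⟨hr, Comp.outerBreak hb, ((Comp.outerBreak hb).mul hb (Comp.sample 0)).sub hb Comp.one,
      fun c l => by simp [Ctx.bind]⟩
  · exact ⟨hr, hr.innerStat hb, ((hr.innerStat hb).mul hb (Comp.sample 0)).sub hb Comp.one,
      fun c l => by simp [Ctx.bind]⟩
  · exact ⟨hr, hr.innerP hb, hr.innerW hb, fun c l => by simp [Ctx.bind]⟩

theorem innerCandidate_feasible (c : Ctx) : (innerCandidate c).1 = √c.ξ ∧ 0 ≤ (innerCandidate c).2.1 := by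
  unfold innerCandidate better
  split_ifs
  · exact ⟨rfl, le_rfl⟩
  · exact ⟨rfl, le_max_left _ _⟩
  · exact ⟨rfl, le_max_left _ _⟩
  · exact ⟨rfl, le_max_left _ _⟩

noncomputable def innerSolution : Ctx → ℝ × ℝ × ℝ := minimize 0 (minimize 1 innerCandidate)

theorem compPoint_innerSolution : CompPoint 5 innerSolution :=
  (compPoint_innerCandidate.minimize le_rfl (by decide)).minimize le_rfl (by decide)

theorem innerSolution_feasible (c : Ctx) : (innerSolution c).1 = √c.ξ ∧ 0 ≤ (innerSolution c).2.1 :=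
  innerCandidate_feasible _

theorem value_minimize_minimize_le (u : Ctx → ℝ × ℝ × ℝ) (c : Ctx) (j k : Fin c.D.n) :
    value (minimize 0 (minimize 1 u)) c ≤ value u ((c.bind 0 j).bind 1 k) :=
  (value_minimize_le 0 (minimize 1 u) c j).trans (value_minimize_le 1 u (c.bind 0 j) k)

theorem value_innerSolution_le (c : Ctx) (hξ : 0 < c.ξ) (h : 0 < c.D.var ∨ 0 ≤ c.D.slack) {p : ℝ}
    (hp : 0 ≤ p) (w : ℝ) : value innerSolution c ≤ c.D.obj √c.ξ p w := by
  obtain ⟨j, k, hjk⟩ := c.D.exists_inner_le h (Real.sqrt_pos.2 hξ) hp w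
  refine (value_minimize_minimize_le innerCandidate c j k).trans ?_
  rcases hjk with h1 | h1 | h1 | h1
  · exact ((value_better_le_left _ _ _).trans (value_better_le_left _ _ _)).trans h1
  · refine ((value_better_le_left _ _ _).trans (value_better_le_right _ _ _)).trans ?_
    simpa [value, Ctx.bind] using h1
  · refine ((value_better_le_right _ _ _).trans (value_better_le_left _ _ _)).trans ?_
    simpa [value, Ctx.bind] using h1
  · refine ((value_better_le_right _ _ _).trans (value_better_le_right _ _ _)).trans ?_
    simpa [value, Ctx.bind] using h1

/-! ### The algorithm for the dual problem -/

noncomputable def outerCandidate (c : Ctx) : ℝ × ℝ × ℝ :=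
  better (fun c => (c.D.outerR (c.env 0) (c.D.outerBreak (c.env 0) (c.env 1)),
      c.D.outerBreak (c.env 0) (c.env 1), c.D.outerBreak (c.env 0) (c.env 1) * c.D.x (c.env 0) - 1))
    (fun c => (c.D.outerR (c.env 0) (c.D.outerStat (c.env 0) (c.env 1)),
      c.D.outerStat (c.env 0) (c.env 1), c.D.outerStat (c.env 0) (c.env 1) * c.D.x (c.env 0) - 1)) c

theorem compPoint_outerCandidate {base : ℕ} (hb : base ≤ 5) : CompPoint base outerCandidate := by
  refine CompPoint.better hb ?_ ?_
  · exact ⟨(Comp.outerBreak hb).outerR hb, Comp.outerBreak hb,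
      ((Comp.outerBreak hb).mul hb (Comp.sample 0)).sub hb Comp.one, fun c l => by simp [Ctx.bind]⟩
  · exact ⟨(Comp.outerStat hb).outerR hb, Comp.outerStat hb,
      ((Comp.outerStat hb).mul hb (Comp.sample 0)).sub hb Comp.one, fun c l => by simp [Ctx.bind]⟩

theorem outerCandidate_feasible (c : Ctx) : 0 ≤ (outerCandidate c).1 ∧ 0 ≤ (outerCandidate c).2.1 := by
  unfold outerCandidate better
  split_ifs <;> exact ⟨le_max_left _ _, le_max_left _ _⟩

noncomputable def outerSolution : Ctx → ℝ × ℝ × ℝ := minimize 0 (minimize 1 outerCandidate)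

theorem compPoint_outerSolution {base : ℕ} (hb : base ≤ 5) : CompPoint base outerSolution :=
  ((compPoint_outerCandidate hb).minimize hb (by decide)).minimize hb (by decide)

theorem outerSolution_feasible (c : Ctx) : 0 ≤ (outerSolution c).1 ∧ 0 ≤ (outerSolution c).2.1 :=
  outerCandidate_feasible _

theorem value_outerSolution_le (c : Ctx) (h : -(2 * |c.D.σ| * √c.D.var) ≤ c.D.slack) {r p : ℝ}
    (hr : 0 < r) (hp : 0 ≤ p) (w : ℝ) (h1 : c.D.obj r p w < 1) :
    value outerSolution c ≤ c.D.obj r p w := by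
  obtain ⟨j, k, hjk⟩ := c.D.exists_outer_le h hr hp w h1
  refine (value_minimize_minimize_le outerCandidate c j k).trans ?_
  rcases hjk with h1 | h1
  · refine (value_better_le_left _ _ _).trans ?_
    simpa [value, Ctx.bind] using h1
  · refine (value_better_le_right _ _ _).trans ?_
    simpa [value, Ctx.bind] using h1

/-! ### Polynomial time solvability -/

theorem inner_polyTime : PolyTime (Inst := LZPM × {ξ : ℝ // 0 < ξ}) (fun I => I.1.n)
    (fun I => [I.1.δ, I.1.μ, I.1.σ, I.1.τ, I.2.1] ++ List.ofFn I.1.x)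
    (fun I s => I.1.InnerSolved I.2.1 s) := by
  have hb : 5 ≤ 5 := le_rfl
  have hu := compPoint_innerSolution
  -- The outputs undo the rescaling, with 0 as padding for cell 3. The flag is nonnegative exactly
  -- when var > 0 or slack ≥ 0.
  obtain ⟨P, q, hP⟩ := Comp.output hb (hu.value hb) (hu.r.mul hb hu.p)
    (((Comp.two.mul hb hu.r).mul hb hu.w).sub hb ((Comp.two.mul hb (hu.r.sq hb)).mul hb Comp.threshold))
    Comp.zero (Comp.zero.ite_lt hb (Comp.var hb) Comp.one
      ((Comp.slack hb).ite_lt hb Comp.zero (Comp.one.neg hb) Comp.one))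
  refine ⟨P, q, fun I => ?_⟩
  obtain ⟨D, ξ, hξ⟩ := I
  obtain ⟨s, t, he, ht, h0, h1, h2, -, h4⟩ := hP ⟨D, ξ, fun _ => ⟨0, D.n_pos⟩⟩
    (start D.n ([D.δ, D.μ, D.σ, D.τ, ξ] ++ List.ofFn D.x)) (by
      refine ⟨?_, ?_, ?_, ?_, ?_, ?_, ?_, ?_⟩ <;> simp [start, Nat.add_comm 5])
  refine ⟨s, t, he, ht, ?_⟩
  set c : Ctx := ⟨D, ξ, fun _ => ⟨0, D.n_pos⟩⟩ with hc
  have hr := Real.sqrt_pos.2 hξ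
  have hsq : √ξ ^ 2 = ξ := Real.sq_sqrt hξ.le
  by_cases h : 0 < D.var ∨ 0 ≤ D.slack
  · left
    obtain ⟨f1, f2⟩ := innerSolution_feasible c
    have hval : D.innerValue ξ = ((value innerSolution c : ℝ) : EReal) := by
      rw [← hsq]
      refine le_antisymm ?_ ((D.le_innerValue_iff hr _).2 fun p w hp => ?_)
      · have := D.innerValue_le hr f2 (innerSolution c).2.2
        rwa [← f1] at this ⊢
      · exact EReal.coe_le_coe_iff.2 (value_innerSolution_le c hξ h hp w)
    have f1' : (innerSolution c).1 = √ξ := f1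
    refine ⟨?_, ?_, ?_, ?_⟩
    · rw [h4]
      have : ¬ (if 0 < D.var then (1 : ℝ) else if D.slack < 0 then -1 else 1) < 0 := by
        rcases h with h | h
        · rw [if_pos h]; norm_num
        · rw [if_neg (not_lt.2 h)]; split_ifs <;> norm_num
      exact if_neg this
    · rw [h0, hval]
    · rw [h1, f1']; exact mul_nonneg hr.le f2
    · rw [hval, h1, h2, f1']
      have := D.dualObj_scaled hr (innerSolution c).2.1 (innerSolution c).2.2
      rw [hsq] at this
      rw [hsq, this, value, f1']
  · right
    push Not at h
    refine ⟨?_, ?_⟩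
    · rw [h4]
      have : (if 0 < D.var then (1 : ℝ) else if D.slack < 0 then -1 else 1) < 0 := by
        rw [if_neg (not_lt.2 h.1), if_pos h.2]; norm_num
      exact if_pos this
    · have := D.innerValue_eq_bot (le_antisymm h.1 D.var_nonneg) h.2 hr
      rwa [hsq] at this

theorem dual_polyTime : PolyTime (Inst := LZPM) (fun D => D.n)
    (fun D => [D.δ, D.μ, D.σ, D.τ] ++ List.ofFn D.x) (fun D s => D.DualSolved s) := by
  have hb : 4 ≤ 5 := by norm_num
  have hu := compPoint_outerSolution hb
  have hv := hu.value hb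
  -- The best candidate is used only if its value is below 1; otherwise the output is λ = 0 with
  -- value 1. The flag computes |σ| as √(σ²).
  obtain ⟨P, q, hP⟩ := Comp.output hb (hv.ite_lt hb Comp.one hv Comp.one)
    (hv.ite_lt hb Comp.one (hu.r.mul hb hu.p) Comp.zero)
    (hv.ite_lt hb Comp.one (((Comp.two.mul hb hu.r).mul hb hu.w).sub hb
      ((Comp.two.mul hb (hu.r.sq hb)).mul hb Comp.threshold)) Comp.zero)
    (hv.ite_lt hb Comp.one ((hu.r.sq hb).sub hb (hu.r.mul hb hu.p)) Comp.zero)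
    ((Comp.slack hb).ite_lt hb (((Comp.two.mul hb ((Comp.deviation.sq hb).sqrt hb)).mul hb
      ((Comp.var hb).sqrt hb)).neg hb) (Comp.one.neg hb) Comp.one)
  refine ⟨P, q, fun D => ?_⟩
  obtain ⟨s, t, he, ht, h0, h1, h2, h3, h4⟩ := hP ⟨D, 0, fun _ => ⟨0, D.n_pos⟩⟩
    (start D.n ([D.δ, D.μ, D.σ, D.τ] ++ List.ofFn D.x)) (by
      refine ⟨?_, ?_, ?_, ?_, ?_, ?_, ?_, ?_⟩ <;> simp [start, Nat.add_comm 4])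
  refine ⟨s, t, he, ht, ?_⟩
  set c : Ctx := ⟨D, 0, fun _ => ⟨0, D.n_pos⟩⟩ with hc
  simp only [Real.sqrt_sq_eq_abs] at h4
  have h4 : s.idx 0 = if (if D.slack < -(2 * |D.σ| * √D.var) then (-1 : ℝ) else 1) < 0 then 0 else 1 := h4
  by_cases h : D.slack < -(2 * |D.σ| * √D.var)
  · right
    refine ⟨?_, D.dualValue_eq_bot h⟩
    rw [h4, if_pos h, if_pos (by norm_num)]
  left
  refine ⟨by rw [h4, if_neg h, if_neg (by norm_num)], ?_⟩
  rw [not_lt] at h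
  obtain ⟨f1, f2⟩ := outerSolution_feasible c
  by_cases hlt : value outerSolution c < 1
  · simp only [if_pos hlt] at h0 h1 h2 h3
    have hr : 0 < (outerSolution c).1 := by
      refine lt_of_le_of_ne f1 fun h0 => ?_
      rw [value, ← h0, obj] at hlt
      linarith [c.D.one_le_gap (outerSolution c).2.1 (outerSolution c).2.2]
    have hval : D.dualValue = ((value outerSolution c : ℝ) : EReal) := by
      refine le_antisymm ((D.le_dualValue_iff _).1 le_rfl _ _ _ hr f2)
        ((D.le_dualValue_iff _).2 fun r p w hr hp => ?_)
      rw [EReal.coe_le_coe_iff]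
      by_cases h1 : D.obj r p w < 1
      · exact value_outerSolution_le c h hr hp w h1
      · exact hlt.le.trans (not_lt.1 h1)
    refine ⟨by rw [hval, h0], by rw [h1]; exact mul_nonneg f1 f2, ?_⟩
    rw [hval, h1, h2, h3]
    exact D.dualObj_scaled hr _ _
  · simp only [if_neg hlt] at h0 h1 h2 h3
    have hval : D.dualValue = 1 := by
      refine le_antisymm ?_ ((D.le_dualValue_iff _).2 fun r p w hr hp => ?_)
      · rw [← D.dualObj_zero]; exact D.dualValue_le le_rfl 0 0
      · rw [← EReal.coe_one, EReal.coe_le_coe_iff]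
        by_contra! h1
        exact hlt ((value_outerSolution_le c h hr hp w h1).trans_lt h1)
    refine ⟨by rw [hval, h0, EReal.coe_one], by rw [h1], ?_⟩
    rw [hval, h1, h2, h3]
    exact D.dualObj_zero

end LZPM

theorem proposition2p2 :
    -- the functions `Ψᵢ` after the substitution `λ₃ = ξ - λ₁`
    (∀ (D : LZPM) (i : Fin D.n) (l₁ l₂ ξ : ℝ), ¬ (ξ = 0 ∧ l₂ = 2 * l₁ * D.x i) →
      D.psi i l₁ l₂ (ξ - l₁) = D.psiExplicit i l₁ l₂ ξ) ∧
    (∀ (D : LZPM) (i : Fin D.n) (l₁ l₂ ξ : ℝ), ξ = 0 ∧ l₂ = 2 * l₁ * D.x i →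
      D.psi i l₁ l₂ (ξ - l₁) = ((-(l₁ * D.x i ^ 2) + 1 : ℝ) : EReal)) ∧
    -- the objective after the substitution
    (∀ (D : LZPM) (l₁ l₂ ξ : ℝ), ξ ≠ 0 →
      D.dualObj l₁ l₂ (ξ - l₁) = D.explicitObj l₁ l₂ ξ) ∧
    -- the dual problem is the minimization of the explicit objective, and also that of `f` on `ξ > 0`
    (∀ D : LZPM, D.dualValue =
      ⨅ (l₁ : ℝ) (_ : 0 ≤ l₁) (l₂ : ℝ) (ξ : ℝ), D.explicitObj l₁ l₂ ξ) ∧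
    (∀ D : LZPM, D.dualValue = ⨅ (ξ : ℝ) (_ : 0 < ξ), D.innerValue ξ) ∧
    -- `f` is convex on `ξ > 0`
    (∀ (D : LZPM) (ξ η a b : ℝ), 0 < ξ → 0 < η → 0 < a → 0 < b → a + b = 1 →
      D.innerValue (a * ξ + b * η) ≤ (a : EReal) * D.innerValue ξ + (b : EReal) * D.innerValue η) ∧
    -- for fixed `ξ > 0` the inner problem is solved in polynomial time
    RealRAM.PolyTime (Inst := LZPM × {ξ : ℝ // 0 < ξ}) (fun I => I.1.n)
      (fun I => [I.1.δ, I.1.μ, I.1.σ, I.1.τ, I.2.1] ++ List.ofFn I.1.x)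
      (fun I s => I.1.InnerSolved I.2.1 s) ∧
    -- the dual problem is solved in polynomial time
    RealRAM.PolyTime (Inst := LZPM) (fun D => D.n)
      (fun D => [D.δ, D.μ, D.σ, D.τ] ++ List.ofFn D.x)
      (fun D s => D.DualSolved s) :=
  ⟨LZPM.psi_eq_psiExplicit, LZPM.psi_exceptional, LZPM.dualObj_eq_explicitObj,
    LZPM.dualValue_eq_iInf_explicitObj, LZPM.dualValue_eq_iInf_innerValue, LZPM.innerValue_convex,
    LZPM.inner_polyTime, LZPM.dual_polyTime⟩
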